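/- A \emph{loose graph} is a finite graph in which edges with only one or with no end point (\emph{loose edges}) are also allowed (two different edges never have the same two end points). Its \emph{completion} $\overline{T}$ is the graph obtained by adding a new vertex at every missing end of every edge; a \emph{loose tree} is a loose graph $T$ that is connected and has no cycles, i.e. such that $\overline{T}$ is a tree. A vertex of $T$ is \emph{inner} if its degree in $\overline{T}$ is not $1$. Let $m$ be the number of vertices of $\overline{T}$. For a field $k$, take a projective space $\mathbf{PG}(m-1,k)$ with homogeneous coordinates indexed by the vertices of $\overline{T}$. The space $\mathcal{X}_k=\mathcal{F}(T)\otimes_{\mathbb{F}_1}k$ is the union, in $\mathbf{PG}(m-1,k)$, of the local affine spaces $\mathbb{A}_v$, $v$ a vertex of $T$, where $\mathbb{A}_v$ is the complement of the hyperplane $x_v=0$ in the projective subspace spanned by the basis points of $v$ and of its neighbours in $\overline{T}$ (an edge without vertices contributes a multiplicative group: the line on its two ends in $\overline{T}$, minus these two points). View $\mathcal{X}_k$ as a point-line geometry: the points are the $k$-rational points of $\mathcal{X}_k$, and the lines are the projective $k$-lines contained in $\mathcal{X}_k$ and the complete affine lines, i.e. those whose projective completion meets $\mathcal{X}_k$ in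 the whole projective line minus one point. Let $\mathrm{Aut}^{\mathrm{comb}}(\mathcal{X}_k)$ be the group of automorphisms of this geometry (pairs of a permutation of the points and a permutation of the lines preserving incidence in both directions). Let $\mathrm{Aut}^{\mathrm{proj}}(\mathcal{X}_k)$ be the group of elements of $\mathbf{P\Gamma L}_m(k)$ stabilizing the set of points of $\mathcal{X}_k$, modulo the subgroup of those acting trivially on it. \textbf{Theorem.} Let $T$ be a loose tree with at least two inner vertices, and let $k$ be any field with more than two elements. Then $$\mathrm{Aut}^{\mathrm{comb}}(\mathcal{X}_k)\;\cong\;\mathrm{Aut}^{\mathrm{proj}}(\mathcal{X}_k).$$ -/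

import Mathlib

open scoped LinearAlgebra.Projectivization

universe u v w

/-- A loose graph with vertex set `V` and edge set `E`: every edge has at most two end points
(so edges with one or with no end point are allowed), and two different edges never have the
same two end points. -/
structure LooseGraph (V : Type u) (E : Type v) where
  /-- The set of end points of an edge. -/
  ends : E → Finset V
  card_ends_le : ∀ e, (ends e).card ≤ 2
  simple : ∀ e f, (ends e).card = 2 → ends e = ends f → e = f

namespace LooseGraph

variable {V : Type u} {E : Type v} (T : LooseGraph V E)

/-- The vertices of the graph theoretical completion: the vertices of `T`, together with one new
vertex for every missing end of every edge. -/
abbrev CompletionVertex : Type (max u v) := V ⊕ (Σ e : E, Fin (2 - (T.ends e).card))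

/-- The two ends of the edge `e` in the completion. -/
def completedEnds (e : E) : Set T.CompletionVertex :=
  {a | Sum.elim (fun x : V => x ∈ T.ends e) (fun p => p.1 = e) a}

/-- The graph theoretical completion of `T`. -/
def completion : SimpleGraph T.CompletionVertex where
  Adj a b := a ≠ b ∧ ∃ e : E, a ∈ T.completedEnds e ∧ b ∈ T.completedEnds e
  symm := ⟨fun _ _ h => ⟨h.1.symm, h.2.imp fun _ he => ⟨he.2, he.1⟩⟩⟩
  loopless := ⟨fun _ h => h.1 rfl⟩

/-- A loose tree is a connected loose graph without cycles. As the completion only adds end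
points to loose edges, this says that the completion is a tree. -/
def IsLooseTree : Prop := T.completion.IsTree

/-- The boundary: the vertices of degree `1` in the completion. -/
def boundary : Set T.CompletionVertex := {a | (T.completion.neighborSet a).ncard = 1}

/-- The inner vertices: the vertices which are not in the boundary (the new vertices of the
completion all have degree `1`, so inner vertices are vertices of `T`). -/
def innerVertices : Set V := {x | Sum.inl x ∉ T.boundary}

section Geometry

variable (k : Type w) [Field k]

/-- The vector space underlying the ambient projective space `PG(m - 1, k)`, with one canonical
basis vector for each of the `m` vertices of the completion. -/
abbrev Ambient : Type (max u v w) := T.CompletionVertex → k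

/-- The `k`-points of the local affine space at a vertex `x`: in the projective space spanned by
`x` and its neighbours in the completion, the complement of the hyperplane spanned by the
neighbours. Its dimension is the degree of `x`. -/
def localAffine (x : V) : Set (ℙ k (T.Ambient k)) :=
  {p | p.rep (Sum.inl x) ≠ 0 ∧
    ∀ a, p.rep a ≠ 0 → a = Sum.inl x ∨ T.completion.Adj (Sum.inl x) a}

/-- The `k`-points of the multiplicative group that belongs to an edge `e` without vertices: the
projective line spanned by the two ends of `e` in the completion, without these two ends. -/
def edgeTorus (e : E) : Set (ℙ k (T.Ambient k)) :=
  {p | ∀ a, p.rep a ≠ 0 ↔ a ∈ T.completedEnds e}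

/-- The set of `k`-rational points of `X_k = F(T) ⊗ k`, embedded in its ambient projective space:
the union of the local affine spaces at the vertices of `T` (and of the multiplicative groups
of the edges without vertices). -/
def points : Set (ℙ k (T.Ambient k)) :=
  (⋃ x : V, T.localAffine k x) ∪ ⋃ (e : E) (_ : T.ends e = ∅), T.edgeTorus k e

/-- The set of points of the projective subspace that belongs to a linear subspace. -/
def pointsOf (L : Submodule k (T.Ambient k)) : Set (ℙ k (T.Ambient k)) :=
  {p | p.submodule ≤ L}

/-- The lines of `X_k`: the projective lines of the ambient space which are contained in `X_k`,
and the complete affine lines, i.e. those whose projective completion meets `X_k` in the whole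
projective line minus one point. A line is represented by its projective completion. -/
def IsLine (L : Submodule k (T.Ambient k)) : Prop :=
  Module.finrank k L = 2 ∧
    (T.pointsOf k L ⊆ T.points k ∨
      ∃ p ∈ T.pointsOf k L, T.pointsOf k L ∩ T.points k = T.pointsOf k L \ {p})

/-- The type of lines of `X_k`. -/
abbrev Line : Type (max u v w) := {L : Submodule k (T.Ambient k) // T.IsLine k L}

/-- The incidence relation between the points and the lines of `X_k`. -/
def Incident (p : T.points k) (L : T.Line k) : Prop := p.1 ∈ T.pointsOf k L.1

/-- The combinatorial automorphism group of `X_k`: the automorphisms of the point-line geometry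
of `X_k`, i.e. the pairs of a permutation of the points and a permutation of the lines
that preserve incidence. -/
def AutComb : Subgroup (Equiv.Perm (T.points k) × Equiv.Perm (T.Line k)) where
  carrier := {g | ∀ p L, T.Incident k (g.1 p) (g.2 L) ↔ T.Incident k p L}
  one_mem' := fun _ _ => Iff.rfl
  mul_mem' := fun {g h} hg hh p L => (hg (h.1 p) (h.2 L)).trans (hh p L)
  inv_mem' := fun {g} hg p L => by
    have := hg (g⁻¹.1 p) (g⁻¹.2 L)
    simpa using this.symm

end Geometry

end LooseGraph

/-- The group `PΓL(W)` of automorphisms of the projective space of `W`: the permutations of its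
points that are induced by bijective semilinear maps. -/
def PGammaL (k : Type*) (W : Type*) [Field k] [AddCommGroup W] [Module k W] :
    Subgroup (Equiv.Perm (ℙ k W)) where
  carrier := {g | ∃ (σ : k ≃+* k) (f : W ≃+ W), (∀ (c : k) (x : W), f (c • x) = σ c • f x) ∧
    ∀ (x : W) (hx : x ≠ 0),
      g (Projectivization.mk k x hx) =
        Projectivization.mk k (f x) ((map_ne_zero_iff f f.injective).2 hx)}
  one_mem' := ⟨RingEquiv.refl k, AddEquiv.refl W, fun _ _ => rfl, fun _ _ => rfl⟩
  mul_mem' := by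
    rintro g h ⟨σ, f, hf, hg⟩ ⟨τ, f', hf', hh⟩
    refine ⟨τ.trans σ, f'.trans f, fun c x => ?_, fun x hx => ?_⟩
    · simp [hf, hf']
    · rw [Equiv.Perm.mul_apply, hh x hx, hg]
      rfl
  inv_mem' := by
    rintro g ⟨σ, f, hf, hg⟩
    refine ⟨σ.symm, f.symm, fun c x => ?_, fun x hx => ?_⟩
    · apply f.injective
      simp [hf]
    · rw [Equiv.Perm.inv_eq_iff_eq, hg]
      simp

namespace LooseGraph

variable {V : Type u} {E : Type v} (T : LooseGraph V E) (k : Type w) [Field k]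

/-- The automorphisms of the ambient projective space that stabilize `X_k` setwise. -/
def ambientStabilizer : Subgroup (Equiv.Perm (ℙ k (T.Ambient k))) where
  carrier := {g | g ∈ PGammaL k (T.Ambient k) ∧ ∀ p, g p ∈ T.points k ↔ p ∈ T.points k}
  one_mem' := ⟨one_mem _, fun _ => Iff.rfl⟩
  mul_mem' := fun {_ h} hg hh => ⟨mul_mem hg.1 hh.1, fun p => (hg.2 (h p)).trans (hh.2 p)⟩
  inv_mem' := fun {g} hg => ⟨inv_mem hg.1, fun p => by
    have := hg.2 (g⁻¹ p)
    simpa using this.symm⟩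

/-- The action of the stabilizer of `X_k` on the points of `X_k`. -/
def restrictHom : T.ambientStabilizer k →* Equiv.Perm (T.points k) where
  toFun g := g.1.subtypePerm g.2.2
  map_one' := rfl
  map_mul' _ _ := rfl

/-- The projective automorphism group of `X_k`: the automorphisms of the ambient projective space
that stabilize `X_k`, modulo those that act trivially on `X_k`. -/
abbrev AutProj : Type (max u v w) := T.ambientStabilizer k ⧸ (T.restrictHom k).ker

end LooseGraph

/-! Both groups embed in the permutations of the points of X, and the theorem says that the two
images agree. A line of X lacks at most one projective point, so it is determined by its points in X
(`Line.ext_of_incident`). Hence `AutComb` acts faithfully on points, while `AutProj` is the image of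
`restrictHom` by the first isomorphism theorem. One inclusion is formal: a semilinear bijection
stabilizing X permutes its lines (`exists_mem_autComb`). The other says that every collineation α is
induced by a semilinear bijection of the ambient space.

To prove this, the local affine spaces at inner vertices are first recovered from collinearity.
Collinear points have coordinates supported on vertices at distance at most two, and in a tree a set
of vertices with pairwise distance at most two lies in one star; so α sends a local affine space
into the span of another one (`exists_inner_of_pairwise_col`). A point of the image at infinity
would make two parallel lines of the source meet inside X, which is impossible
(`exists_inAffine_apply`). Applying this to the inverse gives a bijection between local affine
spaces.

An inner vertex has degree at least two, so the fundamental theorem of affine geometry makes α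
semilinear on its star (`exists_semilinear_on_star`). At adjacent inner vertices the two field
automorphisms coincide, and the images of the two shared basis vectors differ by one scalar
(`exists_eq_and_smul_of_adj`). Since a tree has no cycles, these scalars come from a potential on
the vertices (`IsTree.exists_potential`); rescaling by it glues the local maps into a global one
(`exists_semilinear`, `exists_addEquiv`). -/

/-! ### The fundamental theorem of affine geometry. -/

section AffineGeometry

variable {k : Type*} [Field k] {U U' : Type*} [AddCommGroup U] [Module k U]
  [AddCommGroup U'] [Module k U']

/-- A map sends affine lines into affine lines. -/
def MapsLines (k : Type*) [Field k] {U U' : Type*} [AddCommGroup U] [Module k U]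
    [AddCommGroup U'] [Module k U'] (γ : U → U') : Prop :=
  ∀ (a b : U) (t : k), ∃ s : k, γ (a + t • (b - a)) = γ a + s • (γ b - γ a)

theorem MapsLines.exists_smul {γ : U → U'} (h : MapsLines k γ) (h0 : γ 0 = 0) (u : U) (t : k) :
    ∃ s : k, γ (t • u) = s • γ u := by
  simpa [h0] using h 0 u t

theorem MapsLines.linearIndependent_pair {γ : U ≃ U'} (h' : MapsLines k γ.symm) (h0 : γ 0 = 0)
    {u v : U} (huv : LinearIndependent k ![u, v]) : LinearIndependent k ![γ u, γ v] := by
  have h0' : γ.symm 0 = 0 := by rw [Equiv.symm_apply_eq, h0]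
  have hu0 : u ≠ 0 := huv.ne_zero 0
  rw [LinearIndependent.pair_iff' hu0] at huv
  rw [LinearIndependent.pair_iff' fun hu => hu0 (γ.injective (hu.trans h0.symm))]
  intro a hav
  obtain ⟨s, hs⟩ := h'.exists_smul h0' (γ u) a
  rw [hav] at hs
  simp only [Equiv.symm_apply_apply] at hs
  exact huv s hs.symm

/-- The vector `u + v` lies on the line joining `t₀ • u` to `μ • v` with `μ = -t₀ / (1 - t₀)`, and
these two points stay on the lines through the origin and the images of `u` and `v`. This replaces
the midpoint construction and works in characteristic two, provided some `t₀` differs from 0 and 1.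
-/
theorem exists_eq_smul_add_of_mapsLines {t₀ : k} (ht0 : t₀ ≠ 0) (ht1 : t₀ ≠ 1) {γ : U → U'}
    (h : MapsLines k γ) (h0 : γ 0 = 0) (u v : U) :
    ∃ a b : k, γ (u + v) = a • γ u + b • γ v := by
  have h1 : 1 - t₀ ≠ 0 := sub_ne_zero.2 ht1.symm
  obtain ⟨s₁, hs₁⟩ := h.exists_smul h0 u t₀
  obtain ⟨s₂, hs₂⟩ := h.exists_smul h0 v (-t₀ / (1 - t₀))
  set μ := -t₀ / (1 - t₀) with hμ
  have hμ0 : μ ≠ 0 := div_ne_zero (neg_ne_zero.2 ht0) h1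
  obtain ⟨s, hs⟩ := h (t₀ • u) (μ • v) μ⁻¹
  have e1 : t₀ - μ⁻¹ * t₀ = 1 := by rw [hμ]; field_simp; ring
  have e : t₀ • u + μ⁻¹ • (μ • v - t₀ • u) = u + v := by
    rw [smul_sub, smul_smul, smul_smul, inv_mul_cancel₀ hμ0, one_smul]
    rw [← add_sub_assoc, add_sub_right_comm, ← sub_smul, e1, one_smul]
  rw [e, hs₁, hs₂] at hs
  refine ⟨s₁ - s * s₁, s * s₂, hs.trans ?_⟩
  module

/-- If `a ≠ 1`, the line joining `γ u` to `γ (u + v)` meets the line spanned by `γ v`. Pulled back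
by `γ.symm`, this gives a common point of the parallel lines `u + k v` and `k v`. -/
theorem MapsLines.coeff_eq_one {γ : U ≃ U'} (h' : MapsLines k γ.symm)
    (h0 : γ 0 = 0) {u v : U} (huv : LinearIndependent k ![u, v]) {a b : k}
    (hab : γ (u + v) = a • γ u + b • γ v) : a = 1 := by
  by_contra ha
  have h0' : γ.symm 0 = 0 := by rw [Equiv.symm_apply_eq, h0]
  have h1 : 1 - a ≠ 0 := sub_ne_zero.2 (Ne.symm ha)
  obtain ⟨s, hs⟩ := h' (γ u) (γ (u + v)) (1 - a)⁻¹
  have e1 : 1 + (1 - a)⁻¹ * (a - 1) = 0 := by field_simp; ring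
  have e : γ u + (1 - a)⁻¹ • (γ (u + v) - γ u) = ((1 - a)⁻¹ * b) • γ v := by
    rw [hab]
    calc _ = (1 + (1 - a)⁻¹ * (a - 1)) • γ u + ((1 - a)⁻¹ * b) • γ v := by module
      _ = _ := by rw [e1, zero_smul, zero_add]
  obtain ⟨r, hr⟩ := h'.exists_smul h0' (γ v) ((1 - a)⁻¹ * b)
  rw [e, hr] at hs
  simp only [Equiv.symm_apply_apply, add_sub_cancel_left] at hs
  have := (LinearIndependent.pair_iff.1 huv) 1 (s - r)
    (by rw [sub_smul, hs]; module)
  exact one_ne_zero this.1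

theorem MapsLines.map_add_of_linearIndependent {t₀ : k} (ht0 : t₀ ≠ 0) (ht1 : t₀ ≠ 1)
    {γ : U ≃ U'} (h : MapsLines k γ) (h' : MapsLines k γ.symm) (h0 : γ 0 = 0) {u v : U}
    (huv : LinearIndependent k ![u, v]) : γ (u + v) = γ u + γ v := by
  obtain ⟨a, b, hab⟩ := exists_eq_smul_add_of_mapsLines ht0 ht1 h h0 u v
  have ha := h'.coeff_eq_one h0 huv hab
  have hb := h'.coeff_eq_one h0 (u := v) (v := u) (a := b) (b := a)
    (LinearIndependent.pair_symm_iff.1 huv) (by rw [add_comm, hab, add_comm])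
  rw [hab, ha, hb, one_smul, one_smul]

theorem exists_linearIndependent_pair_of_ne_zero {u₀ v₀ u : U}
    (h : LinearIndependent k ![u₀, v₀]) (hu : u ≠ 0) : ∃ w, LinearIndependent k ![u, w] := by
  by_contra! H
  simp only [LinearIndependent.pair_iff' hu, not_forall, not_not] at H
  obtain ⟨a, ha⟩ := H u₀
  obtain ⟨b, hb⟩ := H v₀
  have := LinearIndependent.pair_iff.1 h b (-a) (by rw [← ha, ← hb]; module)
  have h0 := h.ne_zero 1
  apply h0
  simp [← hb, this.1]

/-- The fundamental theorem of affine geometry, with fixed origin: a bijection that preserves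
affine lines in both directions is semilinear. -/
theorem exists_semilinear_of_mapsLines {t₀ : k} (ht0 : t₀ ≠ 0) (ht1 : t₀ ≠ 1)
    {u₀ v₀ : U} (hind : LinearIndependent k ![u₀, v₀]) {γ : U ≃ U'} (h : MapsLines k γ)
    (h' : MapsLines k γ.symm) (h0 : γ 0 = 0) :
    ∃ σ : k ≃+* k, (∀ u v, γ (u + v) = γ u + γ v) ∧ ∀ (c : k) (u : U), γ (c • u) = σ c • γ u := by
  have hadd : ∀ {u v : U}, LinearIndependent k ![u, v] → γ (u + v) = γ u + γ v :=
    fun huv => h.map_add_of_linearIndependent ht0 ht1 h' h0 huv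
  have hne : ∀ {u : U}, u ≠ 0 → γ u ≠ 0 := fun hu hγ => hu (γ.injective (hγ.trans h0.symm))
  choose s hs using fun u t => h.exists_smul h0 u t
  -- Expanding `γ (t • (u + v))` in two ways forces the multipliers of `u` and `v` to equal that of
  -- `u + v`.
  have hsind : ∀ {u v : U}, LinearIndependent k ![u, v] → ∀ t, s u t = s v t := by
    intro u v huv t
    by_cases ht : t = 0
    · have hz : ∀ {x : U}, x ≠ 0 → s x 0 = 0 := by
        intro x hx
        have := hs x 0
        rw [zero_smul, h0] at this
        exact (smul_eq_zero.1 this.symm).resolve_right (hne hx)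
      have hu : u ≠ 0 := huv.ne_zero 0
      have hv : v ≠ 0 := huv.ne_zero 1
      rw [ht, hz hu, hz hv]
    · have e1 := hs (u + v) t
      have htuv : LinearIndependent k ![t • u, t • v] := by
        rw [LinearIndependent.pair_iff] at huv ⊢
        intro a b hab
        have := huv (a * t) (b * t) (by rw [mul_smul, mul_smul, hab])
        exact ⟨(mul_eq_zero.1 this.1).resolve_right ht, (mul_eq_zero.1 this.2).resolve_right ht⟩
      rw [smul_add, hadd htuv, hadd huv, hs u, hs v] at e1
      have := LinearIndependent.pair_iff.1 (h'.linearIndependent_pair h0 huv)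
        (s u t - s (u + v) t) (s v t - s (u + v) t) (by
          rw [smul_add] at e1
          rw [sub_smul, sub_smul, sub_add_sub_comm, e1, sub_self])
      rw [sub_eq_zero.1 this.1, sub_eq_zero.1 this.2]
  have hsall : ∀ u v : U, u ≠ 0 → v ≠ 0 → ∀ t, s u t = s v t := by
    intro u v hu hv t
    by_cases huv : LinearIndependent k ![u, v]
    · exact hsind huv t
    -- Proportional vectors are compared through a third one independent of both; this is where
    -- dimension at least two is needed.
    · obtain ⟨w, hw⟩ := exists_linearIndependent_pair_of_ne_zero hind hu
      rw [LinearIndependent.pair_iff' hu] at huv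
      push Not at huv
      obtain ⟨a, rfl⟩ := huv
      have ha : a ≠ 0 := fun ha => hv (by rw [ha, zero_smul])
      have hvw : LinearIndependent k ![a • u, w] := by
        rw [LinearIndependent.pair_iff] at hw ⊢
        intro x y hxy
        have := hw (x * a) y (by rw [mul_smul, hxy])
        exact ⟨(mul_eq_zero.1 this.1).resolve_right ha, this.2⟩
      rw [hsind hw t, hsind hvw t]
  have hu₀ : u₀ ≠ 0 := hind.ne_zero 0
  have hv₀ : v₀ ≠ 0 := hind.ne_zero 1
  have hσ : ∀ (c : k) (u : U), γ (c • u) = s u₀ c • γ u := by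
    intro c u
    by_cases hu : u = 0
    · simp [hu, h0]
    · rw [hs, hsall u u₀ hu hu₀]
  have huniq : ∀ a b : k, a • γ u₀ = b • γ u₀ → a = b := fun a b hab =>
    smul_left_injective k (hne hu₀) hab
  have hone : s u₀ 1 = 1 := huniq _ _ (by rw [← hσ, one_smul, one_smul])
  have hmul : ∀ a b, s u₀ (a * b) = s u₀ a * s u₀ b := fun a b =>
    huniq _ _ (by rw [← hσ, mul_smul, mul_smul, hσ, hσ])
  have hzero : s u₀ 0 = 0 := huniq _ _ (by rw [← hσ, zero_smul, zero_smul, h0])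
  have haddl : ∀ a b : k, γ (a • u₀ + b • u₀) = γ (a • u₀) + γ (b • u₀) := by
    intro a b
    by_cases hb : b = 0
    · simp [hb, h0]
    -- Shearing the first summand by `v₀` makes the two summands independent, so the additivity
    -- already known applies; `γ v₀` cancels afterwards.
    have i1 : LinearIndependent k ![a • u₀ + v₀, b • u₀] := by
      rw [LinearIndependent.pair_iff] at hind ⊢
      intro x y hxy
      have := hind (x * a + y * b) x (by rw [← hxy]; module)
      refine ⟨this.2, ?_⟩
      have h2 := this.1
      rw [this.2, zero_mul, zero_add] at h2
      exact (mul_eq_zero.1 h2).resolve_right hb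
    have i2 : ∀ c : k, γ (c • u₀ + v₀) = γ (c • u₀) + γ v₀ := by
      intro c
      by_cases hc : c = 0
      · simp [hc, h0]
      · refine hadd ?_
        rw [LinearIndependent.pair_iff] at hind ⊢
        intro x y hxy
        have := hind (x * c) y (by rw [mul_smul, hxy])
        exact ⟨(mul_eq_zero.1 this.1).resolve_right hc, this.2⟩
    have e := hadd i1
    rw [add_right_comm, ← add_smul, i2, i2] at e
    rw [← add_smul]
    have : γ ((a + b) • u₀) + γ v₀ = (γ (a • u₀) + γ (b • u₀)) + γ v₀ := by rw [e]; abel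
    exact add_right_cancel this
  have hsadd : ∀ a b, s u₀ (a + b) = s u₀ a + s u₀ b := fun a b =>
    huniq _ _ (by rw [← hσ, add_smul, haddl, hσ, hσ, add_smul])
  let σ₀ : k →+* k :=
    { toFun := s u₀, map_one' := hone, map_mul' := hmul, map_zero' := hzero, map_add' := hsadd }
  have hsurj : Function.Surjective σ₀ := by
    intro c
    have h0' : γ.symm 0 = 0 := by rw [Equiv.symm_apply_eq, h0]
    obtain ⟨t, ht⟩ := h'.exists_smul h0' (γ u₀) c
    rw [Equiv.symm_apply_apply, Equiv.symm_apply_eq, hσ] at ht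
    exact ⟨t, (huniq _ _ ht).symm⟩
  refine ⟨RingEquiv.ofBijective σ₀ ⟨σ₀.injective, hsurj⟩, ?_, hσ⟩
  intro u v
  by_cases huv : LinearIndependent k ![u, v]
  · exact hadd huv
  · by_cases hu : u = 0
    · simp [hu, h0]
    rw [LinearIndependent.pair_iff' hu] at huv
    push Not at huv
    obtain ⟨a, rfl⟩ := huv
    calc γ (u + a • u) = γ ((1 + a) • u) := by rw [add_smul, one_smul]
      _ = s u₀ (1 + a) • γ u := hσ _ _
      _ = γ u + s u₀ a • γ u := by rw [hsadd, hone, add_smul, one_smul]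
      _ = _ := by rw [hσ]

end AffineGeometry

/-! ### Stars and potentials in trees. -/

namespace SimpleGraph

variable {I : Type*} {G : SimpleGraph I}

/-- The vertex `x` together with its neighbours. -/
def star (G : SimpleGraph I) (x : I) : Set I := {a | a = x ∨ G.Adj x a}

/-- Two vertices that lie in a common star. -/
def Near (G : SimpleGraph I) (a b : I) : Prop := ∃ x, a ∈ G.star x ∧ b ∈ G.star x

theorem near_iff {a b : I} : G.Near a b ↔ a = b ∨ G.Adj a b ∨ ∃ c, G.Adj a c ∧ G.Adj c b := by
  constructor
  · rintro ⟨x, rfl | ha, rfl | hb⟩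
    · exact Or.inl rfl
    · exact Or.inr (Or.inl hb)
    · exact Or.inr (Or.inl ha.symm)
    · exact Or.inr (Or.inr ⟨x, ha.symm, hb⟩)
  · rintro (rfl | h | ⟨c, hac, hcb⟩)
    · exact ⟨a, Or.inl rfl, Or.inl rfl⟩
    · exact ⟨a, Or.inl rfl, Or.inr h⟩
    · exact ⟨c, Or.inr hac.symm, Or.inr hcb⟩

theorem IsAcyclic.length_eq (hG : G.IsAcyclic) {a b : I} {p q : G.Walk a b} (hp : p.IsPath)
    (hq : q.IsPath) : p.length = q.length :=
  congrArg (fun r : G.Path a b => r.1.length) ((hG.subsingleton_path a b).elim ⟨p, hp⟩ ⟨q, hq⟩)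

theorem IsAcyclic.not_adj_of_common_neighbor (hG : G.IsAcyclic) {a b c : I} (hab : G.Adj a b)
    (hbc : G.Adj b c) : ¬G.Adj a c := by
  intro hac
  have := hG.length_eq (p := .cons hab (.cons hbc .nil)) (q := .cons hac .nil)
    (by simp [hab.ne, hbc.ne, hac.ne]) (by simp [hac.ne])
  simp at this

theorem IsAcyclic.not_near_of_length (hG : G.IsAcyclic) {a b : I} {p : G.Walk a b}
    (hp : p.IsPath) (h3 : 3 ≤ p.length) : ¬G.Near a b := by
  intro h
  rcases near_iff.1 h with rfl | h | ⟨c, hac, hcb⟩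
  · have := hG.length_eq hp (q := .nil) (by simp)
    rw [Walk.length_nil] at this; omega
  · have := hG.length_eq hp (q := .cons h .nil) (by simp [h.ne])
    simp at this; omega
  · by_cases hab : a = b
    · subst hab
      have := hG.length_eq hp (q := .nil) (by simp)
      rw [Walk.length_nil] at this; omega
    have := hG.length_eq hp (q := .cons hac (.cons hcb .nil)) (by simp [hac.ne, hcb.ne, hab])
    simp at this; omega

/-- In an acyclic graph, sets of vertices with pairwise distance at most two lie in a star. -/
theorem IsAcyclic.exists_subset_star (hG : G.IsAcyclic) [Nonempty I] {S : Set I}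
    (hS : ∀ a ∈ S, ∀ b ∈ S, G.Near a b) : ∃ x, S ⊆ G.star x := by
  by_cases h : ∀ a ∈ S, ∀ b ∈ S, a = b ∨ G.Adj a b
  · rcases S.eq_empty_or_nonempty with rfl | ⟨a, ha⟩
    · exact ⟨Classical.arbitrary I, Set.empty_subset _⟩
    · exact ⟨a, fun b hb => (h a ha b hb).imp_left Eq.symm⟩
  push Not at h
  obtain ⟨a, ha, b, hb, hab, hnab⟩ := h
  rcases near_iff.1 (hS a ha b hb) with h | h | ⟨x, hax, hxb⟩
  · exact absurd h hab
  · exact absurd h hnab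
  refine ⟨x, fun c hc => ?_⟩
  by_contra hcx
  simp only [star, Set.mem_ofPred_eq, not_or] at hcx
  obtain ⟨hcx, hxc⟩ := hcx
  have hca : c ≠ a := by rintro rfl; exact hxc hax.symm
  have hcb : c ≠ b := by rintro rfl; exact hxc hxb
  -- A vertex `c` outside the star of the midpoint `x` of `a` and `b` but close to `a` is joined to
  -- `b` by a path of length 3 or 4 through `a` and `x`, hence is too far from `b`.
  rcases near_iff.1 (hS c hc a ha) with h | h | ⟨z, hcz, hza⟩
  · exact hca h
  · refine hG.not_near_of_length (p := .cons h (.cons hax (.cons hxb .nil))) ?_ (by simp)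
      (hS c hc b hb)
    simp [hca, hcx, hcb, hax.ne, hab, hxb.ne]
  · have hzx : z ≠ x := by rintro rfl; exact hxc hcz.symm
    have hzb : z ≠ b := by rintro rfl; exact hnab hza.symm
    refine hG.not_near_of_length (p := .cons hcz (.cons hza (.cons hax (.cons hxb .nil)))) ?_
      (by simp) (hS c hc b hb)
    simp [hca, hcx, hcb, hax.ne, hab, hxb.ne, hcz.ne, hza.ne, hzx, hzb]

/-- The product of edge weights along a walk. -/
def Walk.weight {H : Type*} [Monoid H] (w : I → I → H) : ∀ {a b : I}, G.Walk a b → H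
  | _, _, .nil => 1
  | a, _, .cons (v := b) _ p => w a b * p.weight w

theorem Walk.weight_concat {H : Type*} [Monoid H] (w : I → I → H) {a b c : I} (p : G.Walk a b)
    (h : G.Adj b c) : (p.concat h).weight w = p.weight w * w b c := by
  induction p with
  | nil => simp [Walk.weight, Walk.concat_nil]
  | cons h' p ih => simp [Walk.weight, Walk.concat_cons, ih, mul_assoc]

/-- On a tree, antisymmetric edge weights come from a potential. -/
theorem IsTree.exists_potential (hG : G.IsTree) {H : Type*} [Group H] (w : I → I → H)
    (hw : ∀ a b, G.Adj a b → w a b * w b a = 1) :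
    ∃ c : I → H, ∀ a b, G.Adj a b → c b = c a * w a b := by
  obtain ⟨r⟩ := hG.connected.nonempty
  choose P hP hu using fun v => hG.existsUnique_path r v
  have key : ∀ a b (h : G.Adj a b), b ∉ (P a).support →
      (P b).weight w = (P a).weight w * w a b := by
    intro a b h hb
    rw [← hu b ((P a).concat h) ((hP a).concat hb h), Walk.weight_concat]
  refine ⟨fun v => (P v).weight w, fun a b h => ?_⟩
  -- The potential is the weight of the path from the root. Of two adjacent vertices one lies off
  -- the path to the other, so one path extends the other by this edge.
  by_cases hb : b ∈ (P a).support
  · have ha : a ∉ (P b).support := by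
      intro ha
      exact hG.isAcyclic.ne_mem_support_of_support_of_adj_of_isPath (hP a) (hP b) h hb ha
    have h1 := key b a h.symm ha
    dsimp only at h1 ⊢
    rw [h1, mul_assoc, hw b a h.symm, mul_one]
  · exact key a b h hb

end SimpleGraph

/-! ### Boundary and inner vertices of a loose tree. -/

namespace LooseGraph

variable {V : Type u} {E : Type v} (T : LooseGraph V E)

theorem completedEnds_eq (e : E) : T.completedEnds e =
    ↑((T.ends e).disjSum (Finset.univ.map
      (Function.Embedding.sigmaMk (β := fun e : E => Fin (2 - (T.ends e).card)) e))) := by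
  ext a
  rcases a with x | ⟨e', i⟩
  · simp [completedEnds]
  · simp only [completedEnds, Set.mem_ofPred_eq, Sum.elim_inr, Finset.mem_coe,
      Finset.inr_mem_disjSum, Finset.mem_map, Finset.mem_univ, Function.Embedding.sigmaMk_apply,
      true_and]
    constructor
    · rintro rfl; exact ⟨i, rfl⟩
    · rintro ⟨j, hj⟩
      exact (congrArg Sigma.fst hj).symm

theorem ncard_completedEnds (e : E) : (T.completedEnds e).ncard = 2 := by
  rw [completedEnds_eq, Set.ncard_coe_finset, Finset.card_disjSum, Finset.card_map,
    Finset.card_univ, Fintype.card_fin]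
  have := T.card_ends_le e
  omega

theorem inr_mem_boundary (p : Σ e : E, Fin (2 - (T.ends e).card)) :
    (Sum.inr p : T.CompletionVertex) ∈ T.boundary := by
  have hp : Sum.inr p ∈ T.completedEnds p.1 := rfl
  have : T.completion.neighborSet (Sum.inr p) = T.completedEnds p.1 \ {Sum.inr p} := by
    ext b
    simp only [SimpleGraph.mem_neighborSet, completion, Set.mem_sdiff, Set.mem_singleton_iff]
    constructor
    · rintro ⟨hne, e, he, hb⟩
      obtain rfl : p.1 = e := he
      exact ⟨hb, hne.symm⟩
    · rintro ⟨hb, hne⟩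
      exact ⟨Ne.symm hne, p.1, hp, hb⟩
  rw [boundary, Set.mem_ofPred_eq, this, Set.ncard_sdiff_singleton_of_mem hp,
    ncard_completedEnds]

theorem exists_inl_of_notMem_boundary {a : T.CompletionVertex} (ha : a ∉ T.boundary) :
    ∃ x : V, a = Sum.inl x := by
  rcases a with x | p
  · exact ⟨x, rfl⟩
  · exact absurd (T.inr_mem_boundary p) ha

variable {T}

theorem exists_inner_pair (hI : 2 ≤ T.innerVertices.ncard) :
    ∃ a b, a ∉ T.boundary ∧ b ∉ T.boundary ∧ a ≠ b := by
  obtain ⟨x, hx, y, hy, hxy⟩ := Set.one_lt_ncard_iff_nontrivial_and_finite.1 hI |>.1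
  exact ⟨Sum.inl x, Sum.inl y, hx, hy, fun h => hxy (Sum.inl_injective h)⟩

theorem exists_two_neighbors (hT : T.IsLooseTree)
    (hI : 2 ≤ T.innerVertices.ncard) {a : T.CompletionVertex} (ha : a ∉ T.boundary) :
    ∃ b c, T.completion.Adj a b ∧ T.completion.Adj a c ∧ b ≠ c := by
  obtain ⟨x, y, -, -, hxy⟩ := exists_inner_pair hI
  have : Nontrivial T.CompletionVertex := ⟨x, y, hxy⟩
  obtain ⟨b, hb⟩ := hT.connected.preconnected.exists_adj_of_nontrivial a
  by_contra! h
  apply ha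
  refine Set.ncard_eq_one.2 ⟨b, Set.eq_singleton_iff_unique_mem.2 ⟨hb, fun c hc => ?_⟩⟩
  exact h c b hc hb

/-- Two adjacent leaves would form a whole connected component, leaving no inner vertex. -/
theorem exists_inner_neighbor (hT : T.IsLooseTree) (hI : 2 ≤ T.innerVertices.ncard)
    {a : T.CompletionVertex} (ha : a ∈ T.boundary) :
    ∃ x, x ∉ T.boundary ∧ T.completion.Adj a x ∧ ∀ y, T.completion.Adj a y → y = x := by
  obtain ⟨x, hx⟩ := Set.ncard_eq_one.1 (show (T.completion.neighborSet a).ncard = 1 from ha)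
  have hax : T.completion.Adj a x := by
    rw [← SimpleGraph.mem_neighborSet, hx]; rfl
  have huniq : ∀ y, T.completion.Adj a y → y = x := by
    intro y hy
    rw [← SimpleGraph.mem_neighborSet, hx] at hy
    exact hy
  refine ⟨x, fun hxb => ?_, hax, huniq⟩
  obtain ⟨y, hy⟩ := Set.ncard_eq_one.1 (show (T.completion.neighborSet x).ncard = 1 from hxb)
  have hya : ∀ z, T.completion.Adj x z → z = a := by
    intro z hz
    rw [← SimpleGraph.mem_neighborSet, hy] at hz
    have h2 := hax.symm
    rw [← SimpleGraph.mem_neighborSet, hy] at h2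
    exact hz.trans h2.symm
  have hall : ∀ z, z = a ∨ z = x := by
    intro z
    obtain ⟨p⟩ := hT.connected.preconnected a z
    suffices ∀ (b c : T.CompletionVertex), T.completion.Walk b c → (b = a ∨ b = x) →
      (c = a ∨ c = x) from this a z p (Or.inl rfl)
    intro b c p
    induction p with
    | nil => exact id
    | cons h p ih =>
      rintro (rfl | rfl)
      · exact ih (Or.inr (huniq _ h))
      · exact ih (Or.inl (hya _ h))
  obtain ⟨u, v, hu, hv, huv⟩ := exists_inner_pair hI
  rcases hall u with rfl | rfl
  · exact hu ha
  · exact hu hxb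

/-- The star of a leaf is contained in that of its unique neighbour; hence only stars at inner
vertices have to be considered. -/
theorem exists_inner_star (hT : T.IsLooseTree) (hI : 2 ≤ T.innerVertices.ncard)
    (a : T.CompletionVertex) :
    ∃ x : V, Sum.inl x ∉ T.boundary ∧ T.completion.star a ⊆ T.completion.star (Sum.inl x) := by
  by_cases ha : a ∈ T.boundary
  · obtain ⟨x, hx, hax, hu⟩ := exists_inner_neighbor hT hI ha
    obtain ⟨x, rfl⟩ := T.exists_inl_of_notMem_boundary hx
    refine ⟨x, hx, ?_⟩
    rintro b (rfl | hb)
    · exact Or.inr hax.symm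
    · exact Or.inl (hu b hb)
  · obtain ⟨x, rfl⟩ := T.exists_inl_of_notMem_boundary ha
    exact ⟨x, ha, subset_rfl⟩

/-- Removes the multiplicative groups from the definition of `points`: a new vertex is a leaf, so
its edge has an inner end, which is a vertex of T. -/
theorem ends_ne_empty (hT : T.IsLooseTree) (hI : 2 ≤ T.innerVertices.ncard) (e : E) :
    T.ends e ≠ ∅ := by
  intro he
  have h : 0 < 2 - (T.ends e).card := by simp [he]
  obtain ⟨x, hx, ⟨hne, e', he', hx'⟩, -⟩ := exists_inner_neighbor hT hI
    (T.inr_mem_boundary ⟨e, ⟨0, h⟩⟩)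
  obtain rfl : e = e' := he'
  obtain ⟨x, rfl⟩ := T.exists_inl_of_notMem_boundary hx
  have : x ∈ T.ends e := hx'
  simp [he] at this

end LooseGraph

/-! ### Two-dimensional subspaces and linear forms. -/

section PlaneLemmas

variable {k W : Type*} [Field k] [AddCommGroup W] [Module k W]

theorem finrank_span_pair_eq_two {v w : W} (h : LinearIndependent k ![v, w]) :
    Module.finrank k (Submodule.span k {v, w}) = 2 := by
  have := finrank_span_eq_card h
  rwa [Matrix.range_cons_cons_empty, Fintype.card_fin] at this

theorem exists_eq_of_mem_of_finrank_eq_two {L : Submodule k W} (hL : Module.finrank k L = 2)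
    {v w z : W} (hv : v ∈ L) (hw : w ∈ L) (hz : z ∈ L) (h : LinearIndependent k ![v, w]) :
    ∃ a b : k, z = a • v + b • w := by
  have : FiniteDimensional k L := Module.finite_of_finrank_eq_succ hL
  have hle : Submodule.span k {v, w} ≤ L := by
    rw [Submodule.span_le]
    rintro _ (rfl | rfl) <;> assumption
  have heq := Submodule.eq_of_le_of_finrank_eq hle (by rw [finrank_span_pair_eq_two h, hL])
  rw [← heq, Submodule.mem_span_pair] at hz
  obtain ⟨a, b, rfl⟩ := hz
  exact ⟨a, b, rfl⟩

theorem linearIndependent_pair_of_apply {v w : W} (φ : W →ₗ[k] k) (hv : φ v ≠ 0) (hw0 : w ≠ 0)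
    (hw : φ w = 0) : LinearIndependent k ![v, w] := by
  rw [LinearIndependent.pair_iff]
  intro a b hab
  have ha : a = 0 := by
    have := congrArg φ hab
    simpa [hw, hv] using this
  refine ⟨ha, ?_⟩
  simpa [ha, hw0] using hab

theorem exists_ne_zero_apply_eq_zero {L : Submodule k W} (hL : Module.finrank k L = 2)
    (φ : W →ₗ[k] k) : ∃ n ∈ L, n ≠ 0 ∧ φ n = 0 := by
  have : FiniteDimensional k L := Module.finite_of_finrank_eq_succ hL
  have h1 := (φ.domRestrict L).finrank_range_add_finrank_ker
  have h2 : Module.finrank k (LinearMap.range (φ.domRestrict L)) ≤ 1 := by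
    simpa using Submodule.finrank_le (LinearMap.range (φ.domRestrict L))
  have h3 : LinearMap.ker (φ.domRestrict L) ≠ ⊥ := by
    intro h
    rw [h, finrank_bot] at h1
    omega
  obtain ⟨n, hn, hn0⟩ := Submodule.exists_mem_ne_zero_of_ne_bot h3
  exact ⟨n, n.2, by simpa using hn0, by simpa using hn⟩

/-- If `k` has more than two elements, then every projective line has two points outside any two
given points. -/
theorem exists_pair_apply_ne_zero {t : k} (ht0 : t ≠ 0) (ht1 : t ≠ 1) {L : Submodule k W}
    (hL : Module.finrank k L = 2) (φ ψ : W →ₗ[k] k) {v w : W} (hv : v ∈ L) (hw : w ∈ L)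
    (hφ : φ v ≠ 0) (hψ : ψ w ≠ 0) :
    ∃ z₀ ∈ L, ∃ z₁ ∈ L, φ z₀ ≠ 0 ∧ ψ z₀ ≠ 0 ∧ φ z₁ ≠ 0 ∧ ψ z₁ ≠ 0 ∧
      LinearIndependent k ![z₀, z₁] := by
  obtain ⟨z, hz, hzφ, hzψ⟩ : ∃ z ∈ L, φ z ≠ 0 ∧ ψ z ≠ 0 := by
    by_cases h1 : ψ v = 0
    · by_cases h2 : φ w = 0
      · exact ⟨v + w, add_mem hv hw, by simpa [h2], by simpa [h1]⟩
      · exact ⟨w, hw, h2, hψ⟩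
    · exact ⟨v, hv, hφ, h1⟩
  obtain ⟨n, hn, hn0, hnφ⟩ := exists_ne_zero_apply_eq_zero hL φ
  obtain ⟨n', hn', hn0', hnψ⟩ := exists_ne_zero_apply_eq_zero hL ψ
  have shear : ∀ x : W, LinearIndependent k ![z, x] → LinearIndependent k ![z, z + x] := by
    intro x hx
    rw [LinearIndependent.pair_iff] at hx ⊢
    intro a b hab
    have := hx (a + b) b (by rw [← hab]; module)
    exact ⟨by simpa [this.2] using this.1, this.2⟩
  by_cases h1 : ψ n = 0
  · exact ⟨z, hz, z + n, add_mem hz hn, hzφ, hzψ, by simpa [hnφ], by simpa [h1],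
      shear n (linearIndependent_pair_of_apply φ hzφ hn0 hnφ)⟩
  by_cases h2 : φ n' = 0
  · exact ⟨z, hz, z + n', add_mem hz hn', hzφ, hzψ, by simpa [h2], by simpa [hnψ],
      shear n' (linearIndependent_pair_of_apply φ hzφ hn0' h2)⟩
  -- The forms vanish at different points of the line, spanned by `n` and `n'`; every combination
  -- with two nonzero coefficients avoids both, and `t ≠ 1` separates the two chosen.
  refine ⟨n + n', add_mem hn hn', n + t • n', add_mem hn (L.smul_mem t hn'), by simpa [hnφ],
    by simpa [hnψ], by simp [hnφ, ht0, h2], by simpa [hnψ], ?_⟩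
  rw [LinearIndependent.pair_iff]
  intro a b hab
  have e1 : (a + b) * ψ n = 0 := by
    have := congrArg ψ hab
    simp only [map_add, map_smul, hnψ, smul_eq_mul, map_zero] at this
    linear_combination this
  have e2 : (a + b * t) * φ n' = 0 := by
    have := congrArg φ hab
    simp only [map_add, map_smul, hnφ, smul_eq_mul, map_zero] at this
    linear_combination this
  have e1' := (mul_eq_zero.1 e1).resolve_right h1
  have e2' := (mul_eq_zero.1 e2).resolve_right h2
  have hb : b * (t - 1) = 0 := by linear_combination e2' - e1'
  have hb0 := (mul_eq_zero.1 hb).resolve_right (sub_ne_zero.2 ht1)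
  exact ⟨by simpa [hb0] using e1', hb0⟩

end PlaneLemmas

/-! ### Points, lines and collinearity in coordinates. -/

namespace LooseGraph

variable {V : Type u} {E : Type v} (T : LooseGraph V E) (k : Type w) [Field k]

/-- The vectors supported on a vertex and its neighbours. -/
def starSpace (a : T.CompletionVertex) : Submodule k (T.Ambient k) where
  carrier := {v | ∀ b, v b ≠ 0 → b ∈ T.completion.star a}
  zero_mem' := fun b hb => absurd rfl hb
  add_mem' := by
    intro v w hv hw b hb
    by_cases h : v b = 0
    · exact hw b fun h' => hb (by simp [h, h'])
    · exact hv b h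
  smul_mem' := fun c v hv b hb => hv b fun h => hb (by simp [h])

variable {T k}

theorem starSpace_mono {a b : T.CompletionVertex}
    (h : T.completion.star a ⊆ T.completion.star b) : T.starSpace k a ≤ T.starSpace k b :=
  fun _ hv c hc => h (hv c hc)

/-- The vectors that represent points of the local affine spaces. -/
def IsPointVector (v : T.Ambient k) : Prop :=
  ∃ x : V, v (Sum.inl x) ≠ 0 ∧ v ∈ T.starSpace k (Sum.inl x)

theorem IsPointVector.ne_zero {v : T.Ambient k} (h : T.IsPointVector v) : v ≠ 0 := by
  rintro rfl
  obtain ⟨x, hx, -⟩ := h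
  exact hx rfl

theorem IsPointVector.smul {v : T.Ambient k} (h : T.IsPointVector v) {c : k} (hc : c ≠ 0) :
    T.IsPointVector (c • v) := by
  obtain ⟨x, hx, hv⟩ := h
  exact ⟨x, by simp [hc, hx], Submodule.smul_mem _ _ hv⟩

theorem isPointVector_smul_iff {v : T.Ambient k} {c : k} (hc : c ≠ 0) :
    T.IsPointVector (c • v) ↔ T.IsPointVector v := by
  refine ⟨fun h => ?_, fun h => h.smul hc⟩
  have := h.smul (inv_ne_zero hc)
  rwa [smul_smul, inv_mul_cancel₀ hc, one_smul] at this

theorem mem_points_iff (hE : ∀ e, T.ends e ≠ ∅) {p : ℙ k (T.Ambient k)} :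
    p ∈ T.points k ↔ T.IsPointVector p.rep := by
  simp only [points, Set.mem_union, Set.mem_iUnion]
  constructor
  · rintro (⟨x, hx⟩ | ⟨e, he, -⟩)
    · exact ⟨x, hx.1, hx.2⟩
    · exact absurd he (hE e)
  · rintro ⟨x, hx⟩
    exact Or.inl ⟨x, hx.1, hx.2⟩

theorem mk_mem_points_iff (hE : ∀ e, T.ends e ≠ ∅) {v : T.Ambient k} (hv : v ≠ 0) :
    Projectivization.mk k v hv ∈ T.points k ↔ T.IsPointVector v := by
  obtain ⟨a, ha⟩ := Projectivization.exists_smul_eq_mk_rep k v hv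
  rw [mem_points_iff hE, ← ha]
  exact isPointVector_smul_iff a.ne_zero

theorem mk_mem_pointsOf {L : Submodule k (T.Ambient k)} {v : T.Ambient k} (hv : v ≠ 0) :
    Projectivization.mk k v hv ∈ T.pointsOf k L ↔ v ∈ L := by
  change Projectivization.submodule _ ≤ L ↔ _
  rw [Projectivization.submodule_mk, Submodule.span_singleton_le_iff_mem]

/-- This is the only form in which the definition of a line is exploited: at most one projective
point is missing. -/
theorem IsLine.exists_smul_eq (hE : ∀ e, T.ends e ≠ ∅) {L : Submodule k (T.Ambient k)}
    (hL : T.IsLine k L) {v w : T.Ambient k} (hv : v ∈ L) (hw : w ∈ L) (hv0 : v ≠ 0)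
    (hw0 : w ≠ 0) (hv' : ¬T.IsPointVector v) (hw' : ¬T.IsPointVector w) : ∃ c : k, c • v = w := by
  rw [← mk_mem_points_iff hE hv0] at hv'
  rw [← mk_mem_points_iff hE hw0] at hw'
  rw [← mk_mem_pointsOf hv0] at hv
  rw [← mk_mem_pointsOf hw0] at hw
  rw [← Projectivization.mk_eq_mk_iff' k w v hw0 hv0]
  obtain ⟨-, h | ⟨p, hp, h⟩⟩ := hL
  · exact absurd (h hv) hv'
  · have : ∀ q ∈ T.pointsOf k L, q ∉ T.points k → q = p := by
      intro q hq hq'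
      by_contra hqp
      exact hq' (h.ge ⟨hq, hqp⟩).2
    rw [this _ hv hv', this _ hw hw']

/-- All missing points lie on the hyperplane at infinity of `x`, which meets the line in a single
point. -/
theorem isLine_of_le_starSpace (hE : ∀ e, T.ends e ≠ ∅) {x : V} {L : Submodule k (T.Ambient k)}
    (hL : Module.finrank k L = 2) (hLx : L ≤ T.starSpace k (Sum.inl x)) {v : T.Ambient k}
    (hv : v ∈ L) (hvx : v (Sum.inl x) ≠ 0) : T.IsLine k L := by
  refine ⟨hL, ?_⟩
  by_cases h : T.pointsOf k L ⊆ T.points k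
  · exact Or.inl h
  obtain ⟨p, hpL, hp⟩ := Set.not_subset.1 h
  refine Or.inr ⟨p, hpL, Set.ext fun q => ?_⟩
  simp only [Set.mem_inter_iff, Set.mem_sdiff, Set.mem_singleton_iff]
  refine and_congr_right fun hqL => ⟨fun hq hqp => hp (hqp ▸ hq), fun hqp => ?_⟩
  by_contra hq
  have key : ∀ r ∈ T.pointsOf k L, r ∉ T.points k → r.rep ∈ L ∧ r.rep (Sum.inl x) = 0 := by
    intro r hr hr'
    have hrL : r.rep ∈ L := by
      rwa [← mk_mem_pointsOf r.rep_nonzero, r.mk_rep]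
    refine ⟨hrL, ?_⟩
    by_contra h0
    rw [mem_points_iff hE] at hr'
    exact hr' ⟨x, h0, hLx hrL⟩
  obtain ⟨hp1, hp2⟩ := key p hpL hp
  obtain ⟨hq1, hq2⟩ := key q hqL hq
  obtain ⟨a, b, hab⟩ := exists_eq_of_mem_of_finrank_eq_two hL hv hp1 hq1
    (linearIndependent_pair_of_apply (LinearMap.proj (Sum.inl x)) hvx p.rep_nonzero hp2)
  have ha : a = 0 := by
    have := congrFun hab (Sum.inl x)
    simpa [hp2, hq2, hvx] using this
  apply hqp
  rw [← q.mk_rep, ← p.mk_rep, Projectivization.mk_eq_mk_iff']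
  exact ⟨b, by rw [hab, ha, zero_smul, zero_add]⟩

/-- With more than two scalars, at least two points of the line avoid both coordinate hyperplanes,
and at most one of them is missing from X. -/
theorem IsLine.exists_isPointVector (hE : ∀ e, T.ends e ≠ ∅) {t : k} (ht0 : t ≠ 0) (ht1 : t ≠ 1)
    {L : Submodule k (T.Ambient k)} (hL : T.IsLine k L) {v w : T.Ambient k} (hv : v ∈ L)
    (hw : w ∈ L) {a b : T.CompletionVertex} (ha : v a ≠ 0) (hb : w b ≠ 0) :
    ∃ z ∈ L, T.IsPointVector z ∧ z a ≠ 0 ∧ z b ≠ 0 := by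
  obtain ⟨z₀, hz₀, z₁, hz₁, h1, h2, h3, h4, hind⟩ := exists_pair_apply_ne_zero ht0 ht1 hL.1
    (LinearMap.proj a) (LinearMap.proj b) hv hw ha hb
  by_cases h : T.IsPointVector z₀
  · exact ⟨z₀, hz₀, h, h1, h2⟩
  by_cases h' : T.IsPointVector z₁
  · exact ⟨z₁, hz₁, h', h3, h4⟩
  have hz0 : z₀ ≠ 0 := hind.ne_zero 0
  obtain ⟨c, hc⟩ := hL.exists_smul_eq hE hz₀ hz₁ hz0 (hind.ne_zero 1) h h'
  exact absurd hc ((LinearIndependent.pair_iff' hz0).1 hind c)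

/-- The vector `v` represents the point `p`. -/
def Represents (p : T.points k) (v : T.Ambient k) : Prop :=
  ∃ h : v ≠ 0, p.1 = Projectivization.mk k v h

theorem represents_rep (p : T.points k) : T.Represents p p.1.rep :=
  ⟨p.1.rep_nonzero, p.1.mk_rep.symm⟩

theorem IsPointVector.exists_represents (hE : ∀ e, T.ends e ≠ ∅) {v : T.Ambient k}
    (h : T.IsPointVector v) : ∃ p : T.points k, T.Represents p v :=
  ⟨⟨_, (mk_mem_points_iff hE h.ne_zero).2 h⟩, h.ne_zero, rfl⟩

namespace Represents

variable {p q r : T.points k} {v w z : T.Ambient k}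

theorem isPointVector (h : T.Represents p v) (hE : ∀ e, T.ends e ≠ ∅) : T.IsPointVector v := by
  obtain ⟨hv, h⟩ := h
  rw [← mk_mem_points_iff hE hv, ← h]
  exact p.2

theorem smul (h : T.Represents p v) {c : k} (hc : c ≠ 0) : T.Represents p (c • v) := by
  obtain ⟨hv, h⟩ := h
  refine ⟨smul_ne_zero hc hv, ?_⟩
  rw [h, Projectivization.mk_eq_mk_iff']
  exact ⟨c⁻¹, by rw [smul_smul, inv_mul_cancel₀ hc, one_smul]⟩

theorem eq (hp : T.Represents p v) (hq : T.Represents q v) : p = q :=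
  Subtype.ext (hp.2.trans hq.2.symm)

theorem exists_smul (hv : T.Represents p v) (hw : T.Represents p w) :
    ∃ c : k, c ≠ 0 ∧ w = c • v := by
  have := hv.2.symm.trans hw.2
  rw [Projectivization.mk_eq_mk_iff'] at this
  obtain ⟨c, hc⟩ := this
  have hc0 : c ≠ 0 := by
    rintro rfl
    exact hv.1 (by rw [← hc, zero_smul])
  exact ⟨c⁻¹, inv_ne_zero hc0, by rw [← hc, smul_smul, inv_mul_cancel₀ hc0, one_smul]⟩

theorem linearIndependent (hv : T.Represents p v) (hw : T.Represents q w) (h : p ≠ q) :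
    LinearIndependent k ![v, w] := by
  rw [LinearIndependent.pair_iff' hv.1]
  rintro c rfl
  have hc : c ≠ 0 := by
    rintro rfl
    exact hw.1 (zero_smul k v)
  exact h ((hv.smul hc).eq hw)

theorem incident_iff (hv : T.Represents p v) (L : T.Line k) : T.Incident k p L ↔ v ∈ L.1 := by
  obtain ⟨h0, h⟩ := hv
  rw [Incident, h, mk_mem_pointsOf]

end Represents

/-- Three points on a common line. -/
def Col (p q r : T.points k) : Prop :=
  ∃ L : T.Line k, T.Incident k p L ∧ T.Incident k q L ∧ T.Incident k r L

section Col

variable {p q r : T.points k} {v w z : T.Ambient k}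

theorem Col.exists_eq (h : T.Col p q r) (hv : T.Represents p v) (hw : T.Represents q w)
    (hz : T.Represents r z) (hpq : p ≠ q) : ∃ a b : k, z = a • v + b • w := by
  obtain ⟨L, hp, hq, hr⟩ := h
  rw [hv.incident_iff] at hp
  rw [hw.incident_iff] at hq
  rw [hz.incident_iff] at hr
  exact exists_eq_of_mem_of_finrank_eq_two L.2.1 hp hq hr (hv.linearIndependent hw hpq)

/-- Some point of X on the line has both coordinates nonzero, and its support lies in one star. -/
theorem Col.near (hE : ∀ e, T.ends e ≠ ∅) {t : k} (ht0 : t ≠ 0) (ht1 : t ≠ 1) (h : T.Col p q r)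
    (hv : T.Represents p v) (hw : T.Represents q w) {a b : T.CompletionVertex} (ha : v a ≠ 0)
    (hb : w b ≠ 0) : T.completion.Near a b := by
  obtain ⟨L, hp, hq, -⟩ := h
  rw [hv.incident_iff] at hp
  rw [hw.incident_iff] at hq
  obtain ⟨z, -, ⟨x, -, hz⟩, hza, hzb⟩ := L.2.exists_isPointVector hE ht0 ht1 hp hq ha hb
  exact ⟨_, hz a hza, hz b hzb⟩

theorem col_of_starSpace (hE : ∀ e, T.ends e ≠ ∅) {x : V} (hvx : v (Sum.inl x) ≠ 0)
    (hv : v ∈ T.starSpace k (Sum.inl x)) (hw : w ∈ T.starSpace k (Sum.inl x))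
    (hp : T.Represents p v) (hq : T.Represents q w) (hpq : p ≠ q) {a b : k}
    (hr : T.Represents r (a • v + b • w)) : T.Col p q r := by
  have hvm : v ∈ Submodule.span k {v, w} := Submodule.subset_span (by simp)
  have hwm : w ∈ Submodule.span k {v, w} := Submodule.subset_span (by simp)
  refine ⟨⟨Submodule.span k {v, w}, isLine_of_le_starSpace hE
    (finrank_span_pair_eq_two (hp.linearIndependent hq hpq)) ?_ hvm hvx⟩, ?_, ?_, ?_⟩
  · rw [Submodule.span_le]
    rintro _ (rfl | rfl) <;> assumption
  · rwa [hp.incident_iff]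
  · rwa [hq.incident_iff]
  · rw [hr.incident_iff]
    exact add_mem (Submodule.smul_mem _ _ hvm) (Submodule.smul_mem _ _ hwm)

end Col

end LooseGraph

/-! ### Collineations preserve the local affine spaces at inner vertices. -/

namespace LooseGraph

variable {V : Type u} {E : Type v} (T : LooseGraph V E) (k : Type w) [Field k]

open Classical in
/-- The canonical basis vector of a vertex of the completion. -/
noncomputable def vertexVector (a : T.CompletionVertex) : T.Ambient k := Pi.single a 1

@[simp]
theorem vertexVector_self (a : T.CompletionVertex) : T.vertexVector k a a = 1 := by
  simp [vertexVector]

theorem vertexVector_of_ne {a b : T.CompletionVertex} (h : b ≠ a) :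
    T.vertexVector k a b = 0 := by
  simp [vertexVector, h]

theorem vertexVector_ne_zero (a : T.CompletionVertex) : T.vertexVector k a ≠ 0 := by
  intro h
  simpa using congrFun h a

variable {T k}

theorem vertexVector_mem_starSpace {a x : T.CompletionVertex} (h : a ∈ T.completion.star x) :
    T.vertexVector k a ∈ T.starSpace k x := by
  intro b hb
  by_cases hba : b = a
  · rwa [hba]
  · exact absurd (T.vertexVector_of_ne k hba) hb

theorem eq_smul_vertexVector {v : T.Ambient k} {a : T.CompletionVertex}
    (h : ∀ b, b ≠ a → v b = 0) : v = v a • T.vertexVector k a := by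
  funext b
  by_cases hb : b = a
  · simp [hb]
  · simp [h b hb, T.vertexVector_of_ne k hb]

/-- Neighbours of `x` are pairwise non-adjacent, so the only points of X at infinity of a star are
vertices of T. -/
theorem IsPointVector.eq_smul_of_apply_eq_zero (hT : T.IsLooseTree) {v : T.Ambient k}
    (h : T.IsPointVector v) {x : T.CompletionVertex} (hv : v ∈ T.starSpace k x) (hx : v x = 0) :
    ∃ y : V, T.completion.Adj x (Sum.inl y) ∧ v (Sum.inl y) ≠ 0 ∧
      v = v (Sum.inl y) • T.vertexVector k (Sum.inl y) := by
  obtain ⟨y, hy, hvy⟩ := h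
  have hadj : ∀ b, v b ≠ 0 → T.completion.Adj x b := by
    intro b hb
    rcases hv b hb with rfl | h
    · exact absurd hx hb
    · exact h
  refine ⟨y, hadj _ hy, hy, eq_smul_vertexVector fun b hb => ?_⟩
  by_contra hvb
  rcases hvy b hvb with h | h
  · exact hb h
  · exact hT.isAcyclic.not_adj_of_common_neighbor (hadj _ hy) h (hadj b hvb)

theorem IsPointVector.exists_inner (hT : T.IsLooseTree) (hI : 2 ≤ T.innerVertices.ncard)
    {v : T.Ambient k} (h : T.IsPointVector v) :
    ∃ x : V, Sum.inl x ∉ T.boundary ∧ v ∈ T.starSpace k (Sum.inl x) := by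
  obtain ⟨y, -, hvy⟩ := h
  obtain ⟨x, hx, hxy⟩ := exists_inner_star hT hI (Sum.inl y)
  exact ⟨x, hx, starSpace_mono hxy hvy⟩

theorem IsPointVector.near {v : T.Ambient k} (h : T.IsPointVector v) {a b : T.CompletionVertex}
    (ha : v a ≠ 0) (hb : v b ≠ 0) : T.completion.Near a b := by
  obtain ⟨y, -, hvy⟩ := h
  exact ⟨_, hvy a ha, hvy b hb⟩

theorem Represents.ne_of_apply {p q : T.points k} {v w : T.Ambient k} (hv : T.Represents p v)
    (hw : T.Represents q w) {a : T.CompletionVertex} (h : v a = w a) (ha : w a ≠ 0)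
    (hvw : v ≠ w) : p ≠ q := by
  rintro rfl
  obtain ⟨c, -, rfl⟩ := hv.exists_smul hw
  rw [Pi.smul_apply, smul_eq_mul] at h ha
  have hva : v a ≠ 0 := fun h => ha (by simp [h])
  have : c = 1 := by
    apply mul_right_cancel₀ hva
    rw [← h, one_mul]
  exact hvw (by rw [this, one_smul])

/-- A set of pairwise collinear points is contained in the span of a local affine space. -/
theorem exists_inner_of_pairwise_col (hT : T.IsLooseTree) (hI : 2 ≤ T.innerVertices.ncard)
    {t : k} (ht0 : t ≠ 0) (ht1 : t ≠ 1) {S : Set (T.points k)}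
    (hS : ∀ p ∈ S, ∀ q ∈ S, p ≠ q → T.Col p q q) :
    ∃ x : V, Sum.inl x ∉ T.boundary ∧
      ∀ p ∈ S, ∀ v, T.Represents p v → v ∈ T.starSpace k (Sum.inl x) := by
  have hE := ends_ne_empty hT hI
  have : Nonempty T.CompletionVertex := hT.connected.nonempty
  obtain ⟨y, hy⟩ := hT.isAcyclic.exists_subset_star
    (S := {a | ∃ p ∈ S, ∃ v, T.Represents p v ∧ v a ≠ 0}) (by
      rintro a ⟨p, hp, v, hv, ha⟩ b ⟨q, hq, w, hw, hb⟩
      by_cases hpq : p = q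
      · subst hpq
        obtain ⟨c, hc, rfl⟩ := hv.exists_smul hw
        exact (hv.isPointVector hE).near ha fun h => hb (by simp [h])
      · exact (hS p hp q hq hpq).near hE ht0 ht1 hv hw ha hb)
  obtain ⟨x, hx, hyx⟩ := exists_inner_star hT hI y
  exact ⟨x, hx, fun p hp v hv b hb => hyx (hy ⟨p, hp, v, hv, hb⟩)⟩

/-- Two distinct points at infinity of `x` are two vertices; their line would contain a further
point of X at infinity with two nonzero coordinates. -/
theorem Col.apply_ne_zero (hT : T.IsLooseTree) (hE : ∀ e, T.ends e ≠ ∅) {t : k} (ht0 : t ≠ 0)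
    (ht1 : t ≠ 1) {p q r : T.points k} {v w : T.Ambient k} (h : T.Col p q r)
    (hv : T.Represents p v) (hw : T.Represents q w) (hpq : p ≠ q) {x : T.CompletionVertex}
    (hvx : v ∈ T.starSpace k x) (hwx : w ∈ T.starSpace k x) (hv0 : v x = 0) : w x ≠ 0 := by
  intro hw0
  obtain ⟨y, hxy, hy, hy'⟩ :=
    (hv.isPointVector hE).eq_smul_of_apply_eq_zero hT hvx hv0
  obtain ⟨y', hxy', hz, hz'⟩ :=
    (hw.isPointVector hE).eq_smul_of_apply_eq_zero hT hwx hw0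
  obtain ⟨L, hp, hq, -⟩ := h
  rw [hv.incident_iff] at hp
  rw [hw.incident_iff] at hq
  obtain ⟨z, hzL, hzP, hzy, hzy'⟩ := L.2.exists_isPointVector hE ht0 ht1 hp hq hy hz
  obtain ⟨a, b, hab⟩ := exists_eq_of_mem_of_finrank_eq_two L.2.1 hp hq hzL
    (hv.linearIndependent hw hpq)
  have hzx : z ∈ T.starSpace k x := by
    rw [hab]
    exact add_mem (Submodule.smul_mem _ _ hvx) (Submodule.smul_mem _ _ hwx)
  obtain ⟨y'', -, -, hzz⟩ := hzP.eq_smul_of_apply_eq_zero hT hzx (by simp [hab, hv0, hw0])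
  have hy1 : ∀ c, z c ≠ 0 → c = Sum.inl y'' := by
    intro c hc
    by_contra hne
    rw [hzz] at hc
    simp [T.vertexVector_of_ne k hne] at hc
  have hyy : (Sum.inl y : T.CompletionVertex) = Sum.inl y' := (hy1 _ hzy).trans (hy1 _ hzy').symm
  rw [← hyy] at hz' hz
  rw [hz'] at hw
  rw [hy'] at hv
  have h1 := hv.smul (inv_ne_zero hy)
  have h2 := hw.smul (inv_ne_zero hz)
  rw [smul_smul, inv_mul_cancel₀ hy] at h1
  rw [smul_smul, inv_mul_cancel₀ hz] at h2
  exact hpq (h1.eq h2)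

/-- The point `p` lies in the local affine space at `x`. -/
def InAffine (p : T.points k) (x : V) : Prop :=
  ∃ v ∈ T.starSpace k (Sum.inl x), v (Sum.inl x) = 1 ∧ T.Represents p v

theorem Represents.inAffine {p : T.points k} {v : T.Ambient k} (h : T.Represents p v) {x : V}
    (hv : v ∈ T.starSpace k (Sum.inl x)) (hx : v (Sum.inl x) ≠ 0) : T.InAffine p x :=
  ⟨_, Submodule.smul_mem _ (v (Sum.inl x))⁻¹ hv, by simp [hx], h.smul (inv_ne_zero hx)⟩

theorem exists_inAffine (hE : ∀ e, T.ends e ≠ ∅) {x : V} {v : T.Ambient k}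
    (hv : v ∈ T.starSpace k (Sum.inl x)) (hx : v (Sum.inl x) ≠ 0) :
    ∃ p : T.points k, T.Represents p v ∧ T.InAffine p x := by
  obtain ⟨p, hp⟩ := IsPointVector.exists_represents hE ⟨x, hx, hv⟩
  exact ⟨p, hp, hp.inAffine hv hx⟩

theorem inAffine_vertex_iff {p : T.points k} {x y : V}
    (hp : T.Represents p (T.vertexVector k (Sum.inl x))) : T.InAffine p y ↔ x = y := by
  constructor
  · rintro ⟨v, hv, hvy, hpv⟩
    obtain ⟨c, hc, rfl⟩ := hp.exists_smul hpv
    by_contra h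
    have : (Sum.inl y : T.CompletionVertex) ≠ Sum.inl x := fun h' =>
      h (Sum.inl_injective h').symm
    simp [T.vertexVector_of_ne k this] at hvy
  · rintro rfl
    exact ⟨_, vertexVector_mem_starSpace (Or.inl rfl), by simp, hp⟩

/-- A collineation maps local affine spaces at inner vertices into local affine spaces. -/
theorem exists_inAffine_apply (hT : T.IsLooseTree)
    (hI : 2 ≤ T.innerVertices.ncard) {t : k} (ht0 : t ≠ 0) (ht1 : t ≠ 1)
    {α : Equiv.Perm (T.points k)} (hα : ∀ p q r, T.Col (α p) (α q) (α r) ↔ T.Col p q r)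
    {x : V} (hx : Sum.inl x ∉ T.boundary) :
    ∃ x' : V, Sum.inl x' ∉ T.boundary ∧ ∀ p, T.InAffine p x → T.InAffine (α p) x' := by
  have hE := ends_ne_empty hT hI
  have hcol : ∀ p q : T.points k, T.InAffine p x → T.InAffine q x → p ≠ q → T.Col p q q := by
    rintro p q ⟨v, hv, hv1, hpv⟩ ⟨w, hw, hw1, hqw⟩ hpq
    refine col_of_starSpace hE (by simp [hv1]) hv hw hpv hqw hpq (a := 0) (b := 1) ?_
    rwa [zero_smul, one_smul, zero_add]
  obtain ⟨x', hx', hstar⟩ := exists_inner_of_pairwise_col hT hI ht0 ht1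
    (S := α '' {p | T.InAffine p x}) (by
      rintro _ ⟨p, hp, rfl⟩ _ ⟨q, hq, rfl⟩ hpq
      exact (hα p q q).2 (hcol p q hp hq fun h => hpq (congrArg α h)))
  refine ⟨x', hx', fun p hp => ?_⟩
  have hz := represents_rep (α p)
  set z := (α p).1.rep with hzdef
  have hzs := hstar (α p) ⟨p, hp, rfl⟩ z hz
  refine hz.inAffine hzs fun hz0 => ?_
  -- Assume `α p` is at infinity of `x'`. Then every other image is affine, so the images of lines
  -- through `p` are parallel.
  have himg : ∀ q, T.InAffine q x → q ≠ p →
      ∃ y ∈ T.starSpace k (Sum.inl x'), y (Sum.inl x') = 1 ∧ T.Represents (α q) y := by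
    intro q hq hqp
    have h1 := represents_rep (α q)
    have h2 := hstar (α q) ⟨q, hq, rfl⟩ _ h1
    have hne : α p ≠ α q := fun h => hqp (α.injective h).symm
    have h3 := ((hα p q q).2 (hcol p q hp hq hqp.symm)).apply_ne_zero hT hE ht0 ht1 hz h1 hne (x := Sum.inl x')
      hzs h2 hz0
    exact h1.inAffine h2 h3
  obtain ⟨P, hP, hP1, hpP⟩ := hp
  obtain ⟨b, c, hb, hc, hbc⟩ := exists_two_neighbors hT hI hx
  set eb := T.vertexVector k b
  set ec := T.vertexVector k c
  have heb : eb ∈ T.starSpace k (Sum.inl x) := vertexVector_mem_starSpace (Or.inr hb)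
  have hec : ec ∈ T.starSpace k (Sum.inl x) := vertexVector_mem_starSpace (Or.inr hc)
  have hebx : eb (Sum.inl x) = 0 := T.vertexVector_of_ne k hb.ne
  have hecx : ec (Sum.inl x) = 0 := T.vertexVector_of_ne k hc.ne
  have hebb : eb b = 1 := T.vertexVector_self k b
  have hecc : ec c = 1 := T.vertexVector_self k c
  have hebc : eb c = 0 := T.vertexVector_of_ne k hbc.symm
  have hecb : ec b = 0 := T.vertexVector_of_ne k hbc
  set μ := t / (t - 1) with hμ
  have ht1' : t - 1 ≠ 0 := sub_ne_zero.2 ht1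
  have hμt : μ * (t - 1) = t := div_mul_cancel₀ _ ht1'
  have hμ0 : μ ≠ 0 := div_ne_zero ht0 ht1'
  have mk : ∀ i j : k, ∃ q : T.points k, T.Represents q (P + i • eb + j • ec) ∧
      T.InAffine q x := by
    intro i j
    refine exists_inAffine hE (add_mem (add_mem hP (Submodule.smul_mem _ _ heb))
      (Submodule.smul_mem _ _ hec)) ?_
    simp [hP1, hebx, hecx]
  have memst : ∀ i j : k, P + i • eb + j • ec ∈ T.starSpace k (Sum.inl x) := fun i j =>
    add_mem (add_mem hP (Submodule.smul_mem _ _ heb)) (Submodule.smul_mem _ _ hec)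
  have mkne : ∀ {i j i' j' : k} {q q' : T.points k}, T.Represents q (P + i • eb + j • ec) →
      T.Represents q' (P + i' • eb + j' • ec) → (i ≠ i' ∨ j ≠ j') → q ≠ q' := by
    intro i j i' j' q q' h h' hij
    refine h.ne_of_apply (a := Sum.inl x) h' (by simp [hP1, hebx, hecx])
      (by simp [hP1, hebx, hecx]) fun heq => ?_
    have h1 := congrFun heq b
    have h2 := congrFun heq c
    simp only [Pi.add_apply, Pi.smul_apply, hebb, hecb, hebc, hecc, smul_eq_mul, mul_one,
      mul_zero, add_zero, add_right_inj] at h1 h2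
    rcases hij with h | h
    · exact h h1
    · exact h h2
  have hpP' : T.Represents p (P + (0 : k) • eb + (0 : k) • ec) := by simpa using hpP
  -- In plane coordinates along `eb`, `ec` with origin `p`: `s = (1,0)`, `r = (2,1)`, `u = (t,0)`,
  -- `q = (μ,μ)`. The lines `sr` and `pq` are parallel with direction `(1,1)`, `u` lies on `ps`, and
  -- `μ` is chosen so that `q` lies on `ur`.
  obtain ⟨s, hs, hsx⟩ := mk 1 0
  obtain ⟨r, hr, hrx⟩ := mk (1 + 1) 1
  obtain ⟨u, hu, hux⟩ := mk t 0
  obtain ⟨q, hq, hqx⟩ := mk μ μ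
  have hsp : s ≠ p := mkne hs hpP' (by simp)
  have hrp : r ≠ p := mkne hr hpP' (by simp)
  have hup : u ≠ p := mkne hu hpP' (by simp [ht0])
  have hqp : q ≠ p := mkne hq hpP' (by simp [hμ0])
  have hur : u ≠ r := mkne hu hr (by simp)
  have hsr : s ≠ r := mkne hs hr (by simp)
  have xne : ∀ i j : k, (P + i • eb + j • ec) (Sum.inl x) ≠ 0 := by
    intro i j
    simp [hP1, hebx, hecx]
  have c1 : T.Col p s u := by
    refine col_of_starSpace hE (xne 0 0) (memst 0 0) (memst 1 0) hpP' hs hsp.symm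
      (a := 1 - t) (b := t) ?_
    convert hu using 1
    module
  have c2 : T.Col u r q := by
    refine col_of_starSpace hE (xne t 0) (memst t 0) (memst _ 1) hu hr hur
      (a := 1 - μ) (b := μ) ?_
    convert hq using 1
    have : (1 - μ) * t + μ * (1 + 1) = μ := by linear_combination -hμt
    calc _ = P + ((1 - μ) * t + μ * (1 + 1)) • eb + μ • ec := by module
      _ = _ := by rw [this]
  obtain ⟨S, hS, hS1, hS'⟩ := himg s hsx hsp
  obtain ⟨R, hR, hR1, hR'⟩ := himg r hrx hrp
  obtain ⟨U, hU, hU1, hU'⟩ := himg u hux hup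
  obtain ⟨Q, hQ, hQ1, hQ'⟩ := himg q hqx hqp
  obtain ⟨a₁, b₁, e₁⟩ := ((hα _ _ _).2 c1).exists_eq hz hS' hU' (α.injective.ne hsp.symm)
  obtain ⟨a₂, b₂, e₂⟩ := ((hα _ _ _).2 c2).exists_eq hU' hR' hQ' (α.injective.ne hur)
  have hb₁ : b₁ = 1 := by
    have := congrFun e₁ (Sum.inl x')
    simp only [hU1, Pi.add_apply, Pi.smul_apply, hz0, hS1, smul_eq_mul] at this
    linear_combination -this
  have hab₂ : a₂ + b₂ = 1 := by
    have := congrFun e₂ (Sum.inl x')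
    simp only [hQ1, Pi.add_apply, Pi.smul_apply, hU1, hR1, smul_eq_mul] at this
    linear_combination -this
  -- From `U = a₁ • z + S` and `Q = a₂ • U + b₂ • R`, removing the `z`-part of `Q` gives an affine
  -- point common to the images of `sr` and `pq`.
  obtain ⟨m, hm, -⟩ := exists_inAffine (v := a₂ • S + b₂ • R) (x := x') hE
    (add_mem (Submodule.smul_mem _ _ hS) (Submodule.smul_mem _ _ hR))
    (by simp [hS1, hR1, hab₂])
  have d1 : T.Col (α s) (α r) m :=
    col_of_starSpace hE (by simp [hS1]) hS hR hS' hR' (α.injective.ne hsr) hm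
  have d2 : T.Col (α q) (α p) m := by
    refine col_of_starSpace hE (by simp [hQ1]) hQ hzs hQ' hz (α.injective.ne hqp)
      (a := 1) (b := -(a₂ * a₁)) ?_
    convert hm using 1
    rw [e₂, e₁, hb₁]
    module
  obtain ⟨m, rfl⟩ := α.surjective m
  rw [hα] at d1 d2
  have hZ := represents_rep m
  set Z := m.1.rep
  obtain ⟨i₁, j₁, f₁⟩ := d1.exists_eq hs hr hZ hsr
  obtain ⟨i₂, j₂, f₂⟩ := d2.exists_eq hq hpP' hZ hqp
  have g1 := congrFun (f₁.symm.trans f₂) (Sum.inl x)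
  have g2 := congrFun (f₁.symm.trans f₂) b
  have g3 := congrFun (f₁.symm.trans f₂) c
  simp only [Pi.add_apply, Pi.smul_apply, hebb, hecb, hebc, hecc, hebx, hecx, hP1, smul_eq_mul,
    mul_one, mul_zero, add_zero] at g1 g2 g3
  have hij : i₁ + j₁ = 0 := by
    linear_combination g2 - g3 - (P b - P c) * g1
  -- Back in the source, the common point must be the direction of the two parallels, which is at
  -- infinity but not a vertex, hence not in X.
  have hZeq : Z = j₁ • (eb + ec) := by
    have : i₁ = -j₁ := by linear_combination hij
    rw [f₁, this]
    module
  have hZx : Z ∈ T.starSpace k (Sum.inl x) := by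
    rw [hZeq]; exact Submodule.smul_mem _ _ (add_mem heb hec)
  have hj₁ : j₁ ≠ 0 := by
    rintro rfl
    exact hZ.1 (by rw [hZeq, zero_smul])
  obtain ⟨y, -, -, hy⟩ := (hZ.isPointVector hE).eq_smul_of_apply_eq_zero hT hZx
    (by simp [hZeq, hebx, hecx])
  have hsupp : ∀ d, Z d ≠ 0 → d = Sum.inl y := by
    intro d hd
    by_contra hne
    rw [hy] at hd
    simp [T.vertexVector_of_ne k hne] at hd
  exact hbc ((hsupp b (by simp [hZeq, hebb, hecb, hj₁])).trans
    (hsupp c (by simp [hZeq, hebc, hecc, hj₁])).symm)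

/-- Going forth and back sends the local affine space at `x` into that at some `y`; since the point
of vertex `x` lies in no other local affine space, `y = x`. -/
theorem exists_inAffine_apply_iff (hT : T.IsLooseTree)
    (hI : 2 ≤ T.innerVertices.ncard) {t : k} (ht0 : t ≠ 0) (ht1 : t ≠ 1)
    {α : Equiv.Perm (T.points k)} (hα : ∀ p q r, T.Col (α p) (α q) (α r) ↔ T.Col p q r)
    {x : V} (hx : Sum.inl x ∉ T.boundary) :
    ∃ x' : V, ∀ p, T.InAffine p x ↔ T.InAffine (α p) x' := by
  have hE := ends_ne_empty hT hI
  obtain ⟨x', hx', h⟩ := exists_inAffine_apply hT hI ht0 ht1 hα hx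
  obtain ⟨y, hy, h'⟩ := exists_inAffine_apply hT hI ht0 ht1 (α := α.symm)
    (fun p q r => by rw [← hα]; simp) hx'
  refine ⟨x', fun p => ⟨h p, fun hp => ?_⟩⟩
  obtain ⟨p₀, hp₀, hp₀x⟩ := exists_inAffine (k := k) (x := x) hE
    (vertexVector_mem_starSpace (Or.inl rfl)) (by simp)
  have := h' _ (h _ hp₀x)
  rw [Equiv.symm_apply_apply, inAffine_vertex_iff hp₀] at this
  subst this
  simpa using h' _ hp

end LooseGraph

/-! ### Semilinearity on a single star. -/

section AffineGeometry

variable {k : Type*} [Field k] {U U' : Type*} [AddCommGroup U] [Module k U]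
  [AddCommGroup U'] [Module k U']

theorem MapsLines.sub_const {γ : U → U'} (h : MapsLines k γ) (o : U') :
    MapsLines k fun u => γ u - o := by
  intro a b t
  obtain ⟨s, hs⟩ := h a b t
  exact ⟨s, by dsimp only; rw [hs]; module⟩

theorem MapsLines.comp_add_const {γ : U → U'} (h : MapsLines k γ) (o : U) :
    MapsLines k fun u => γ (u + o) := by
  intro a b t
  obtain ⟨s, hs⟩ := h (a + o) (b + o) t
  refine ⟨s, ?_⟩
  dsimp only
  rw [← hs]
  congr 1
  module

end AffineGeometry

namespace LooseGraph

variable {V : Type u} {E : Type v} {T : LooseGraph V E} {k : Type w} [Field k]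

theorem sum_smul_vertexVector [Fintype T.CompletionVertex] (v : T.Ambient k) :
    ∑ a, v a • T.vertexVector k a = v := by
  classical
  conv_rhs => rw [← Finset.univ_sum_single v]
  refine Finset.sum_congr rfl fun a _ => ?_
  funext b
  by_cases hb : b = a
  · subst hb; simp
  · simp [T.vertexVector_of_ne k hb, hb]

/-- The semilinear map that sends the canonical basis to the family `b`. -/
def semilinearExtension [Fintype T.CompletionVertex] (σ : k ≃+* k)
    (b : T.CompletionVertex → T.Ambient k) (v : T.Ambient k) : T.Ambient k :=
  ∑ a, σ (v a) • b a

section SemilinearExtension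

variable [Fintype T.CompletionVertex] (σ : k ≃+* k) (b : T.CompletionVertex → T.Ambient k)

theorem semilinearExtension_add (v w : T.Ambient k) :
    T.semilinearExtension σ b (v + w) =
      T.semilinearExtension σ b v + T.semilinearExtension σ b w := by
  simp [semilinearExtension, add_smul, Finset.sum_add_distrib]

theorem semilinearExtension_smul (c : k) (v : T.Ambient k) :
    T.semilinearExtension σ b (c • v) = σ c • T.semilinearExtension σ b v := by
  simp [semilinearExtension, mul_smul, Finset.smul_sum]

theorem semilinearExtension_vertexVector (a : T.CompletionVertex) :
    T.semilinearExtension σ b (T.vertexVector k a) = b a := by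
  rw [semilinearExtension, Finset.sum_eq_single a]
  · simp
  · intro c _ hc
    rw [T.vertexVector_of_ne k hc, map_zero, zero_smul]
  · simp

end SemilinearExtension

variable (T k) in
/-- The translation vectors of the local affine space at `x`. -/
def linkSpace (x : V) : Submodule k (T.Ambient k) :=
  T.starSpace k (Sum.inl x) ⊓ LinearMap.ker (LinearMap.proj (Sum.inl x))

theorem mem_linkSpace {x : V} {u : T.Ambient k} :
    u ∈ T.linkSpace k x ↔ u ∈ T.starSpace k (Sum.inl x) ∧ u (Sum.inl x) = 0 := by
  simp [linkSpace]

theorem vertexVector_mem_linkSpace_iff {x : V} {a : T.CompletionVertex} :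
    T.vertexVector k a ∈ T.linkSpace k x ↔ T.completion.Adj (Sum.inl x) a := by
  rw [mem_linkSpace]
  constructor
  · rintro ⟨h, h0⟩
    rcases h a (by simp) with rfl | h
    · simp at h0
    · exact h
  · exact fun h => ⟨vertexVector_mem_starSpace (Or.inr h), T.vertexVector_of_ne k h.ne⟩

theorem vertexVector_add_mem_starSpace {x : V} (u : T.linkSpace k x) :
    T.vertexVector k (Sum.inl x) + (u : T.Ambient k) ∈ T.starSpace k (Sum.inl x) :=
  add_mem (vertexVector_mem_starSpace (Or.inl rfl)) (mem_linkSpace.1 u.2).1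

theorem vertexVector_add_apply {x : V} (u : T.linkSpace k x) :
    (T.vertexVector k (Sum.inl x) + (u : T.Ambient k)) (Sum.inl x) = 1 := by
  simp [(mem_linkSpace.1 u.2).2]

theorem exists_linkSpace_equiv (hE : ∀ e, T.ends e ≠ ∅) (x : V) :
    ∃ Φ : T.linkSpace k x ≃ {p : T.points k // T.InAffine p x},
      ∀ u, T.Represents (Φ u).1 (T.vertexVector k (Sum.inl x) + (u : T.Ambient k)) := by
  choose f hf hf' using fun u : T.linkSpace k x => exists_inAffine hE
    (vertexVector_add_mem_starSpace u) (by rw [vertexVector_add_apply]; exact one_ne_zero)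
  refine ⟨Equiv.ofBijective (fun u => ⟨f u, hf' u⟩) ⟨?_, ?_⟩, hf⟩
  · intro u u' h
    have h : f u = f u' := congrArg Subtype.val h
    by_contra hne
    refine (hf u).ne_of_apply (hf u') (a := Sum.inl x) ?_ ?_ ?_ h
    · rw [vertexVector_add_apply, vertexVector_add_apply]
    · rw [vertexVector_add_apply]; exact one_ne_zero
    · exact fun h' => hne (Subtype.ext (add_left_cancel h'))
  · rintro ⟨p, v, hv, hv1, hp⟩
    have hu : v - T.vertexVector k (Sum.inl x) ∈ T.linkSpace k x :=
      mem_linkSpace.2 ⟨sub_mem hv (vertexVector_mem_starSpace (Or.inl rfl)), by simp [hv1]⟩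
    refine ⟨⟨_, hu⟩, Subtype.ext ?_⟩
    have := hf ⟨_, hu⟩
    simp only [add_sub_cancel] at this
    exact this.eq hp

/-- Representatives are normalized to have coordinate 1 at the centre, so a linear relation between
collinear images has coefficients of sum 1 and is an affine one. -/
theorem mapsLines_of_col (hE : ∀ e, T.ends e ≠ ∅) {α : Equiv.Perm (T.points k)}
    (hα : ∀ p q r, T.Col (α p) (α q) (α r) ↔ T.Col p q r) {x x' : V}
    {γ : T.linkSpace k x → T.linkSpace k x'}
    (hγ : ∀ (u : T.linkSpace k x) p, T.Represents p (T.vertexVector k (Sum.inl x) + (u : T.Ambient k)) →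
      T.Represents (α p) (T.vertexVector k (Sum.inl x') + (γ u : T.Ambient k))) :
    MapsLines k γ := by
  intro a b t
  by_cases hab : a = b
  · exact ⟨0, by simp [hab]⟩
  have hne : ∀ u : T.linkSpace k x,
      (T.vertexVector k (Sum.inl x) + (u : T.Ambient k)) (Sum.inl x) ≠ 0 := by
    intro u
    rw [vertexVector_add_apply]
    exact one_ne_zero
  obtain ⟨Φ, hΦ⟩ := exists_linkSpace_equiv (k := k) hE x
  have hp := hΦ a
  have hq := hΦ b
  have hr := hΦ (a + t • (b - a))
  have hpq : (Φ a).1 ≠ (Φ b).1 := fun h => hab (Φ.injective (Subtype.ext h))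
  have hcol : T.Col (Φ a).1 (Φ b).1 (Φ (a + t • (b - a))).1 := by
    refine col_of_starSpace hE (hne a) (vertexVector_add_mem_starSpace a)
      (vertexVector_add_mem_starSpace b) hp hq hpq (a := 1 - t) (b := t) ?_
    convert hr using 1
    simp only [Submodule.coe_add, Submodule.coe_smul, Submodule.coe_sub]
    module
  obtain ⟨i, j, hij⟩ := ((hα _ _ _).2 hcol).exists_eq (hγ _ _ hp) (hγ _ _ hq) (hγ _ _ hr)
    (α.injective.ne hpq)
  have h1 := congrFun hij (Sum.inl x')
  rw [vertexVector_add_apply, Pi.add_apply, Pi.smul_apply, Pi.smul_apply, vertexVector_add_apply,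
    vertexVector_add_apply, smul_eq_mul, smul_eq_mul, mul_one, mul_one] at h1
  obtain rfl : i = 1 - j := by rw [h1]; ring
  refine ⟨j, Subtype.ext (add_left_cancel (hij.trans ?_))⟩
  simp only [Submodule.coe_add, Submodule.coe_smul, Submodule.coe_sub]
  module

/-- A collineation is induced by a semilinear map on each local affine space, and on the vertices
at infinity of that space. -/
theorem exists_semilinear_on_star [Fintype T.CompletionVertex] (hT : T.IsLooseTree)
    (hI : 2 ≤ T.innerVertices.ncard) {t : k} (ht0 : t ≠ 0) (ht1 : t ≠ 1)
    {α : Equiv.Perm (T.points k)} (hα : ∀ p q r, T.Col (α p) (α q) (α r) ↔ T.Col p q r)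
    {x : V} (hx : Sum.inl x ∉ T.boundary) :
    ∃ (σ : k ≃+* k) (b : T.CompletionVertex → T.Ambient k), ∀ p v,
      v ∈ T.starSpace k (Sum.inl x) → T.Represents p v →
        T.Represents (α p) (T.semilinearExtension σ b v) := by
  classical
  have hE := ends_ne_empty hT hI
  obtain ⟨x', hx'⟩ := exists_inAffine_apply_iff hT hI ht0 ht1 hα hx
  obtain ⟨Φ, hΦ⟩ := exists_linkSpace_equiv (k := k) hE x
  obtain ⟨Φ', hΦ'⟩ := exists_linkSpace_equiv (k := k) hE x'
  set δ : T.linkSpace k x ≃ T.linkSpace k x' :=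
    (Φ.trans (α.subtypeEquiv hx')).trans Φ'.symm with hδ
  have hδ1 : ∀ u, (Φ' (δ u)).1 = α (Φ u).1 := by
    intro u
    simp [hδ]
  have hrep : ∀ (u : T.linkSpace k x) p, T.Represents p (T.vertexVector k (Sum.inl x) + (u : T.Ambient k)) →
      T.Represents (α p) (T.vertexVector k (Sum.inl x') + (δ u : T.Ambient k)) := by
    intro u p hp
    have := hΦ' (δ u)
    rwa [hδ1, (hΦ u).eq hp] at this
  have hrep' : ∀ (u : T.linkSpace k x') p, T.Represents p (T.vertexVector k (Sum.inl x') + (u : T.Ambient k)) →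
      T.Represents (α.symm p) (T.vertexVector k (Sum.inl x) + (δ.symm u : T.Ambient k)) := by
    intro u p hp
    have h1 := hΦ (δ.symm u)
    have h2 := hδ1 (δ.symm u)
    rw [Equiv.apply_symm_apply] at h2
    have h3 : (Φ' u).1 = p := (hΦ' u).eq hp
    have h4 : α.symm p = (Φ (δ.symm u)).1 := by
      rw [Equiv.symm_apply_eq, ← h3, h2]
    rwa [h4]
  have hml := mapsLines_of_col hE hα hrep
  have hml' := mapsLines_of_col hE (α := α.symm) (fun p q r => by rw [← hα]; simp) hrep'
  set γ : T.linkSpace k x ≃ T.linkSpace k x' := δ.trans (Equiv.subRight (δ 0)) with hγ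
  have hγδ : ∀ u, γ u = δ u - δ 0 := fun u => rfl
  have hγ1 : MapsLines k γ := hml.sub_const (δ 0)
  have hγ2 : MapsLines k γ.symm := hml'.comp_add_const (δ 0)
  have hγ0 : γ 0 = 0 := by rw [hγδ, sub_self]
  obtain ⟨b, c, hb, hc, hbc⟩ := exists_two_neighbors hT hI hx
  have hind : ∀ {b c} (hb : T.completion.Adj (Sum.inl x) b) (hc : T.completion.Adj (Sum.inl x) c),
      b ≠ c → LinearIndependent k
        ![(⟨_, vertexVector_mem_linkSpace_iff.2 hb⟩ : T.linkSpace k x),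
          ⟨_, vertexVector_mem_linkSpace_iff.2 hc⟩] := by
    intro b c hb hc hbc
    rw [LinearIndependent.pair_iff]
    intro i j hij
    have hij := congrArg Subtype.val hij
    have h1 := congrFun hij b
    have h2 := congrFun hij c
    simp only [Submodule.coe_add, Submodule.coe_smul, Pi.add_apply, Pi.smul_apply,
      vertexVector_self, T.vertexVector_of_ne k hbc, T.vertexVector_of_ne k hbc.symm,
      smul_eq_mul, mul_one, mul_zero, add_zero, zero_add, Submodule.coe_zero, Pi.zero_apply]
      at h1 h2
    exact ⟨h1, h2⟩
  obtain ⟨σ, hadd, hsmul⟩ := exists_semilinear_of_mapsLines ht0 ht1 (hind hb hc hbc) hγ1 hγ2 hγ0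
  let γ' : T.linkSpace k x →+ T.linkSpace k x' := ⟨⟨γ, hγ0⟩, hadd⟩
  let g : T.CompletionVertex → T.linkSpace k x := fun a =>
    if h : T.vertexVector k a ∈ T.linkSpace k x then ⟨_, h⟩ else 0
  have hg : ∀ {a} (h : T.completion.Adj (Sum.inl x) a),
      g a = ⟨_, vertexVector_mem_linkSpace_iff.2 h⟩ := by
    intro a h
    simp only [g, vertexVector_mem_linkSpace_iff, dif_pos h]
  have hgx : g (Sum.inl x) = 0 := by
    simp [g, vertexVector_mem_linkSpace_iff]
  -- The centre goes to the image of the origin and each neighbour to the linear part of its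
  -- translation; outside the star the value is 0 and plays no role.
  let B : T.CompletionVertex → T.Ambient k := fun a =>
    (if a = Sum.inl x then T.vertexVector k (Sum.inl x') + (δ 0 : T.Ambient k) else 0) +
      (γ (g a) : T.Ambient k)
  have hBx : B (Sum.inl x) = T.vertexVector k (Sum.inl x') + (δ 0 : T.Ambient k) := by
    simp [B, hgx, hγ0]
  have hBadj : ∀ a, a ≠ Sum.inl x → B a = (γ (g a) : T.Ambient k) := by
    intro a ha
    simp [B, ha]
  have hlink : ∀ u : T.linkSpace k x, T.semilinearExtension σ B u = (γ u : T.Ambient k) := by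
    intro u
    obtain ⟨hus, hux⟩ := mem_linkSpace.1 u.2
    have hu : u = ∑ a, u.1 a • g a := by
      apply Subtype.ext
      rw [AddSubmonoidClass.coe_finsetSum]
      conv_lhs => rw [← sum_smul_vertexVector u.1]
      refine Finset.sum_congr rfl fun a _ => ?_
      by_cases ha : u.1 a = 0
      · simp [ha]
      · rcases hus a ha with rfl | h
        · exact absurd hux ha
        · rw [hg h]; rfl
    have h1 : γ u = ∑ a, σ (u.1 a) • γ (g a) := by
      conv_lhs => rw [hu]
      change γ' _ = _
      rw [map_sum]
      exact Finset.sum_congr rfl fun a _ => hsmul _ _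
    rw [h1, AddSubmonoidClass.coe_finsetSum]
    refine Finset.sum_congr rfl fun a _ => ?_
    by_cases ha : a = Sum.inl x
    · rw [ha, hux]; simp
    · rw [hBadj a ha]; rfl
  refine ⟨σ, B, fun p v hv hp => ?_⟩
  by_cases hvx : v (Sum.inl x) = 0
  · obtain ⟨y, hxy, hy, hvy⟩ := (hp.isPointVector hE).eq_smul_of_apply_eq_zero hT hv hvx
    obtain ⟨d, hd, hdy⟩ : ∃ d, T.completion.Adj (Sum.inl x) d ∧ Sum.inl y ≠ d := by
      by_cases h : Sum.inl y = b
      · exact ⟨c, hc, h ▸ hbc⟩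
      · exact ⟨b, hb, h⟩
    have hz := represents_rep (α p)
    set z := (α p).1.rep
    -- Here `p` is the vertex at infinity `y`. Its image lies on the image of every line in
    -- direction `y`; two such parallels, based at 0 and at another neighbour `d`, meet only in
    -- their direction, so `i = 0`.
    have hline : ∀ u : T.linkSpace k x, ∃ i j : k,
        z = i • (T.vertexVector k (Sum.inl x') + (δ u : T.Ambient k)) +
          j • (γ (g (Sum.inl y)) : T.Ambient k) := by
      intro u
      have hgy : g (Sum.inl y) ≠ 0 := by
        rw [hg hxy]
        intro h
        exact T.vertexVector_ne_zero k _ (congrArg Subtype.val h)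
      have hne : (Φ u).1 ≠ (Φ (u + g (Sum.inl y))).1 := by
        intro h
        have := Φ.injective (Subtype.ext h)
        rw [left_eq_add] at this
        exact hgy this
      have hcol : T.Col (Φ u).1 (Φ (u + g (Sum.inl y))).1 p := by
        refine col_of_starSpace hE (by rw [vertexVector_add_apply]; exact one_ne_zero)
          (vertexVector_add_mem_starSpace u) (vertexVector_add_mem_starSpace _) (hΦ _) (hΦ _) hne
          (a := -v (Sum.inl y)) (b := v (Sum.inl y)) ?_
        convert hp using 1
        conv_rhs => rw [hvy]
        rw [hg hxy]
        simp only [Submodule.coe_add]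
        module
      obtain ⟨i, j, hij⟩ := ((hα _ _ _).2 hcol).exists_eq (hrep _ _ (hΦ u)) (hrep _ _ (hΦ _)) hz
        (α.injective.ne hne)
      refine ⟨i + j, j, hij.trans ?_⟩
      have : (δ (u + g (Sum.inl y)) : T.Ambient k) = δ u + γ (g (Sum.inl y)) := by
        have h1 := hadd u (g (Sum.inl y))
        rw [hγδ, hγδ u, sub_add_eq_add_sub, sub_left_inj] at h1
        rw [h1]; rfl
      rw [this]
      module
    obtain ⟨i, j, hij⟩ := hline 0
    obtain ⟨i', j', hij'⟩ := hline (g d)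
    have hx'0 : ∀ u : T.linkSpace k x', (u : T.Ambient k) (Sum.inl x') = 0 := fun u =>
      (mem_linkSpace.1 u.2).2
    have hii : i = i' := by
      have := congrFun (hij.symm.trans hij') (Sum.inl x')
      simpa [hx'0] using this
    subst hii
    have hcomb : i • γ (g d) + (j' - j) • γ (g (Sum.inl y)) = 0 := by
      apply Subtype.ext
      have h1 : (γ (g d) : T.Ambient k) = δ (g d) - δ 0 := by rw [hγδ]; rfl
      simp only [Submodule.coe_add, Submodule.coe_smul, Submodule.coe_zero, h1]
      have h2 := sub_eq_zero.2 (hij'.symm.trans hij)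
      rw [← h2]
      module
    have hindγ := hγ2.linearIndependent_pair hγ0 (hind hd hxy hdy.symm)
    rw [← hg hd, ← hg hxy] at hindγ
    have hi := (LinearIndependent.pair_iff.1 hindγ _ _ hcomb).1
    rw [hi, zero_smul, zero_add, ← hBadj _ hxy.ne'] at hij
    rw [hvy, semilinearExtension_smul, semilinearExtension_vertexVector]
    have hj : j ≠ 0 := by
      rintro rfl
      exact hz.1 (by rw [hij, zero_smul])
    have hσ : σ (v (Sum.inl y)) ≠ 0 := by simpa using hy
    rw [hij] at hz
    have := hz.smul (mul_ne_zero hσ (inv_ne_zero hj))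
    rwa [smul_smul, mul_assoc, inv_mul_cancel₀ hj, mul_one] at this
  · set c := v (Sum.inl x) with hcdef
    have hu : c⁻¹ • v - T.vertexVector k (Sum.inl x) ∈ T.linkSpace k x :=
      mem_linkSpace.2 ⟨sub_mem (Submodule.smul_mem _ _ hv)
        (vertexVector_mem_starSpace (Or.inl rfl)), by simp [← hcdef, hvx]⟩
    have hpu := hp.smul (inv_ne_zero hvx)
    have h1 := (hrep ⟨_, hu⟩ p (by simpa using hpu)).smul
      (show σ c ≠ 0 by simpa using hvx)
    convert h1 using 1
    have h2 : v = c • (T.vertexVector k (Sum.inl x) +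
        (c⁻¹ • v - T.vertexVector k (Sum.inl x))) := by
      rw [add_sub_cancel, smul_smul, mul_inv_cancel₀ hvx, one_smul]
    conv_lhs => rw [h2]
    rw [semilinearExtension_smul, semilinearExtension_add, semilinearExtension_vertexVector,
      hlink ⟨_, hu⟩, hBx, hγδ]
    congr 1
    simp only [Submodule.coe_sub]
    abel

end LooseGraph

/-! ### Gluing the local semilinear maps along the tree. -/

namespace LooseGraph

variable {V : Type u} {E : Type v} {T : LooseGraph V E} {k : Type w} [Field k]

theorem exists_eq_and_smul_of_adj [Fintype T.CompletionVertex] (hE : ∀ e, T.ends e ≠ ∅)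
    {α : Equiv.Perm (T.points k)} {σ τ : k ≃+* k} {b c : T.CompletionVertex → T.Ambient k}
    {x y : V} (hxy : T.completion.Adj (Sum.inl x) (Sum.inl y))
    (hb : ∀ p v, v ∈ T.starSpace k (Sum.inl x) → T.Represents p v →
      T.Represents (α p) (T.semilinearExtension σ b v))
    (hc : ∀ p v, v ∈ T.starSpace k (Sum.inl y) → T.Represents p v →
      T.Represents (α p) (T.semilinearExtension τ c v)) :
    σ = τ ∧ ∃ r : k, r ≠ 0 ∧ c (Sum.inl x) = r • b (Sum.inl x) ∧
      c (Sum.inl y) = r • b (Sum.inl y) := by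
  set ex := T.vertexVector k (Sum.inl x) with hex
  set ey := T.vertexVector k (Sum.inl y) with hey
  have hxx : ex ∈ T.starSpace k (Sum.inl x) := vertexVector_mem_starSpace (Or.inl rfl)
  have hyx : ey ∈ T.starSpace k (Sum.inl x) := vertexVector_mem_starSpace (Or.inr hxy)
  have hxy' : ex ∈ T.starSpace k (Sum.inl y) := vertexVector_mem_starSpace (Or.inr hxy.symm)
  have hyy : ey ∈ T.starSpace k (Sum.inl y) := vertexVector_mem_starSpace (Or.inl rfl)
  have hexy : ey (Sum.inl x) = 0 := T.vertexVector_of_ne k hxy.ne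
  obtain ⟨p, hp, -⟩ := exists_inAffine hE hxx (by simp [hex])
  obtain ⟨q, hq, -⟩ := exists_inAffine hE hyy (by simp [hey])
  have hpq : p ≠ q := by
    rintro rfl
    obtain ⟨s, hs, h⟩ := hp.exists_smul hq
    have := congrFun h (Sum.inl x)
    simp only [hexy, Pi.smul_apply, hex, vertexVector_self, smul_eq_mul, mul_one] at this
    exact hs this.symm
  have hpb := hb p _ hxx hp
  have hpc := hc p _ hxy' hp
  have hqb := hb q _ hyx hq
  have hqc := hc q _ hyy hq
  rw [hex, semilinearExtension_vertexVector] at hpb hpc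
  rw [hey, semilinearExtension_vertexVector] at hqb hqc
  obtain ⟨A, hA, hA'⟩ := hpb.exists_smul hpc
  obtain ⟨B, hB, hB'⟩ := hqb.exists_smul hqc
  have hind := LinearIndependent.pair_iff.1
    (hpb.linearIndependent hqb (α.injective.ne hpq))
  -- Both maps describe the image of the point `ex + s • ey` of the common line; `s = 1` gives `B =
  -- A`, and then `τ = σ`.
  have key : ∀ s : k, τ s * B = A * σ s := by
    intro s
    obtain ⟨r, hr, -⟩ := exists_inAffine hE (x := x) (v := ex + s • ey)
      (add_mem hxx (Submodule.smul_mem _ _ hyx)) (by simp [hex, hexy])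
    have hrb := hb r _ (add_mem hxx (Submodule.smul_mem _ _ hyx)) hr
    have hrc := hc r _ (add_mem hxy' (Submodule.smul_mem _ _ hyy)) hr
    rw [semilinearExtension_add, semilinearExtension_smul, hex, hey,
      semilinearExtension_vertexVector, semilinearExtension_vertexVector] at hrb hrc
    obtain ⟨C, -, hC⟩ := hrb.exists_smul hrc
    rw [hA', hB'] at hC
    have h := hind (A - C) (τ s * B - C * σ s) (by
      rw [← sub_eq_zero] at hC
      rw [← hC]
      module)
    rw [sub_eq_zero.1 h.1, sub_eq_zero.1 h.2]
  have hBA : B = A := by simpa using key 1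
  subst hBA
  refine ⟨RingEquiv.ext fun s => ?_, B, hA, hA', hB'⟩
  have := key s
  rw [mul_comm] at this
  exact (mul_left_cancel₀ hB this).symm

/-- A collineation is induced by a semilinear map of the ambient space. -/
theorem exists_semilinear [Fintype T.CompletionVertex] (hT : T.IsLooseTree)
    (hI : 2 ≤ T.innerVertices.ncard) {t : k} (ht0 : t ≠ 0) (ht1 : t ≠ 1)
    {α : Equiv.Perm (T.points k)} (hα : ∀ p q r, T.Col (α p) (α q) (α r) ↔ T.Col p q r) :
    ∃ (σ : k ≃+* k) (b : T.CompletionVertex → T.Ambient k), ∀ p v,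
      T.Represents p v → T.Represents (α p) (T.semilinearExtension σ b v) := by
  classical
  have hE := ends_ne_empty hT hI
  have hloc : ∀ a : T.CompletionVertex, ∃ (σ : k ≃+* k) (b : T.CompletionVertex → T.Ambient k),
      a ∉ T.boundary → ∀ p v, v ∈ T.starSpace k a → T.Represents p v →
        T.Represents (α p) (T.semilinearExtension σ b v) := by
    intro a
    by_cases ha : a ∈ T.boundary
    · exact ⟨RingEquiv.refl k, 0, fun h => absurd ha h⟩
    · obtain ⟨x, rfl⟩ := T.exists_inl_of_notMem_boundary ha
      obtain ⟨σ, b, h⟩ := exists_semilinear_on_star hT hI ht0 ht1 hα ha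
      exact ⟨σ, b, fun _ => h⟩
  choose σ b hb using hloc
  have hadj : ∀ a c, a ∉ T.boundary → c ∉ T.boundary → T.completion.Adj a c →
      σ a = σ c ∧ ∃ r : k, r ≠ 0 ∧ b c a = r • b a a ∧ b c c = r • b a c := by
    intro a c ha hc hac
    obtain ⟨x, rfl⟩ := T.exists_inl_of_notMem_boundary ha
    obtain ⟨y, rfl⟩ := T.exists_inl_of_notMem_boundary hc
    exact exists_eq_and_smul_of_adj hE hac (hb _ ha) (hb _ hc)
  have hscal : ∀ a c, ∃ r : kˣ, a ∉ T.boundary → c ∉ T.boundary → T.completion.Adj a c →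
      b c a = r • b a a ∧ b c c = r • b a c := by
    intro a c
    by_cases h : a ∉ T.boundary ∧ c ∉ T.boundary ∧ T.completion.Adj a c
    · obtain ⟨-, r, hr, h1, h2⟩ := hadj a c h.1 h.2.1 h.2.2
      exact ⟨Units.mk0 r hr, fun _ _ _ => ⟨h1, h2⟩⟩
    · exact ⟨1, fun ha hc hac => absurd ⟨ha, hc, hac⟩ h⟩
  choose r hr using hscal
  -- The weights undo the scalars `r` on edges between inner vertices. The two orientations give
  -- inverse scalars because `b a a` is nonzero; edges at leaves get weight 1.
  obtain ⟨c, hc⟩ := hT.exists_potential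
    (fun a c => if a ∉ T.boundary ∧ c ∉ T.boundary then (r a c)⁻¹ else 1) (by
      intro a d had
      by_cases h : a ∉ T.boundary ∧ d ∉ T.boundary
      · have h' : d ∉ T.boundary ∧ a ∉ T.boundary := h.symm
        simp only [if_pos h, if_pos h']
        have h1 := (hr a d h.1 h.2 had).1
        have h2 := (hr d a h.2 h.1 had.symm).2
        have hne : b a a ≠ 0 := by
          obtain ⟨x, hx⟩ := T.exists_inl_of_notMem_boundary h.1
          obtain ⟨p, hp, -⟩ := exists_inAffine (k := k) (x := x) hE
            (vertexVector_mem_starSpace (Or.inl rfl)) (by simp)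
          rw [← hx] at hp
          have := (hb a h.1 p _ (vertexVector_mem_starSpace (Or.inl rfl)) hp).1
          rwa [semilinearExtension_vertexVector] at this
        rw [h1, smul_smul] at h2
        have h3 : (1 : k) • b a a = ((r d a * r a d : kˣ) : k) • b a a := by
          rw [one_smul]; exact h2
        have h4 : r d a * r a d = 1 := Units.ext (smul_left_injective k hne h3).symm
        rw [← mul_inv, mul_comm, h4, inv_one]
      · have h' : ¬(d ∉ T.boundary ∧ a ∉ T.boundary) := fun h' => h h'.symm
        simp only [if_neg h, if_neg h', mul_one])
  -- Each vertex takes its image from one inner star: its own, or that of its unique neighbour if it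
  -- is a leaf.
  have hcenter : ∀ a, ∃ x, x ∉ T.boundary ∧ (a ∉ T.boundary → x = a) ∧
      (a ∈ T.boundary → ∀ y, T.completion.Adj a y → y = x) := by
    intro a
    by_cases ha : a ∈ T.boundary
    · obtain ⟨x, hx, -, hu⟩ := exists_inner_neighbor hT hI ha
      exact ⟨x, hx, fun h => absurd ha h, fun _ => hu⟩
    · exact ⟨a, ha, fun _ => rfl, fun h => absurd h ha⟩
  choose g hg hg1 hg2 using hcenter
  have hσadj : ∀ a d, T.completion.Adj a d → σ (g a) = σ (g d) := by
    intro a d had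
    by_cases ha : a ∈ T.boundary
    · obtain rfl := hg2 a ha d had
      rw [hg1 _ (hg a)]
    by_cases hd : d ∈ T.boundary
    · obtain rfl := hg2 d hd a had.symm
      rw [hg1 _ (hg d)]
    rw [hg1 _ ha, hg1 _ hd]
    exact (hadj a d ha hd had).1
  obtain ⟨a₀⟩ := hT.connected.nonempty
  have hσ : ∀ a, σ (g a) = σ (g a₀) := by
    intro a
    obtain ⟨p⟩ := hT.connected.preconnected a a₀
    induction p with
    | nil => rfl
    | cons h p ih => rw [hσadj _ _ h, ih]
  -- After rescaling, the image of `a` is the same in every inner star that contains it.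
  have hB : ∀ x a, x ∉ T.boundary → a ∈ T.completion.star x →
      c (g a) • b (g a) a = c x • b x a := by
    rintro x a hx (rfl | hxa)
    · rw [hg1 _ hx]
    · by_cases ha : a ∈ T.boundary
      · rw [← hg2 a ha x hxa.symm]
      · rw [hg1 a ha, (hr x a hx ha hxa).2, smul_smul, hc x a hxa, if_pos ⟨hx, ha⟩, mul_assoc,
          inv_mul_cancel, mul_one]
  refine ⟨σ (g a₀), fun a => c (g a) • b (g a) a, fun p v hv => ?_⟩
  obtain ⟨x, hx, hvx⟩ := (hv.isPointVector hE).exists_inner hT hI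
  have h1 := (hb _ hx p v hvx hv).smul (c (Sum.inl x)).ne_zero
  convert h1 using 1
  rw [← hσ (Sum.inl x), hg1 _ hx]
  simp only [semilinearExtension, Finset.smul_sum]
  refine Finset.sum_congr rfl fun a _ => ?_
  by_cases ha : v a = 0
  · simp [ha]
  · rw [hB _ a hx (hvx a ha)]
    exact smul_comm _ _ _

theorem exists_addEquiv [Finite V] [Finite E] (hT : T.IsLooseTree)
    (hI : 2 ≤ T.innerVertices.ncard) {t : k} (ht0 : t ≠ 0) (ht1 : t ≠ 1)
    {α : Equiv.Perm (T.points k)} (hα : ∀ p q r, T.Col (α p) (α q) (α r) ↔ T.Col p q r) :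
    ∃ (σ : k ≃+* k) (f : T.Ambient k ≃+ T.Ambient k), (∀ c v, f (c • v) = σ c • f v) ∧
      ∀ p v, T.Represents p v → T.Represents (α p) (f v) := by
  have := Fintype.ofFinite T.CompletionVertex
  have hE := ends_ne_empty hT hI
  obtain ⟨σ, b, hb⟩ := exists_semilinear hT hI ht0 ht1 hα
  let F : T.Ambient k →ₗ[k] T.Ambient k := Fintype.linearCombination k b
  have hF : ∀ v : T.Ambient k, T.semilinearExtension σ b v = F fun a => σ (v a) := by
    intro v
    simp [F, semilinearExtension, Fintype.linearCombination_apply]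
  -- Bijectivity comes from surjectivity of α: every point of X is hit, points of X span the
  -- finite-dimensional ambient space, and a surjective endomorphism is injective.
  have hrange : ∀ v, T.IsPointVector v → v ∈ LinearMap.range F := by
    intro v hv
    obtain ⟨p, hp⟩ := hv.exists_represents hE
    obtain ⟨q, rfl⟩ := α.surjective p
    obtain ⟨c, -, rfl⟩ := (hb q _ (represents_rep q)).exists_smul hp
    rw [hF]
    exact Submodule.smul_mem _ _ ⟨_, rfl⟩
  have hvert : ∀ a, T.vertexVector k a ∈ LinearMap.range F := by
    intro a
    obtain ⟨x, -, hax⟩ := exists_inner_star hT hI a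
    have hx := vertexVector_mem_starSpace (T := T) (k := k) (a := Sum.inl x) (x := Sum.inl x) (Or.inl rfl)
    have ha := vertexVector_mem_starSpace (k := k) (hax (Or.inl rfl))
    have h1 := hrange (T.vertexVector k (Sum.inl x)) ⟨x, by simp, hx⟩
    by_cases hxa : Sum.inl x = a
    · rwa [← hxa]
    -- A new vertex of the completion need not be a point of X, so its vector is obtained as a
    -- difference of two point vectors.
    · have h2 := hrange (T.vertexVector k (Sum.inl x) + T.vertexVector k a)
        ⟨x, by simp [T.vertexVector_of_ne k hxa], add_mem hx ha⟩
      simpa using sub_mem h2 h1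
  have hsurj : Function.Surjective F := by
    intro v
    rw [← LinearMap.mem_range, ← sum_smul_vertexVector v]
    exact sum_mem fun a _ => Submodule.smul_mem _ _ (hvert a)
  have hinj : Function.Injective F := LinearMap.injective_iff_surjective.2 hsurj
  refine ⟨σ, AddEquiv.ofBijective (AddMonoidHom.mk' (T.semilinearExtension σ b)
    (semilinearExtension_add σ b)) ⟨fun v w h => ?_, fun v => ?_⟩,
    semilinearExtension_smul σ b, hb⟩
  · simp only [AddMonoidHom.mk'_apply, hF] at h
    exact funext fun a => σ.injective (congrFun (hinj h) a)
  · obtain ⟨w, rfl⟩ := hsurj v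
    exact ⟨fun a => σ.symm (w a), by simp [hF]⟩

end LooseGraph

/-! ### Action of semilinear bijections on points and lines. -/

section Semilinear

variable {k W : Type*} [Field k] [AddCommGroup W] [Module k W] {σ : k ≃+* k} {f : W ≃+ W}

theorem symm_map_smul (hf : ∀ (c : k) (x : W), f (c • x) = σ c • f x) (c : k) (x : W) :
    f.symm (c • x) = σ.symm c • f.symm x := by
  apply f.injective
  simp [hf]

theorem exists_mem_PGammaL (hf : ∀ (c : k) (x : W), f (c • x) = σ c • f x) :
    ∃ g ∈ PGammaL k W, ∀ (x : W) (hx : x ≠ 0), g (Projectivization.mk k x hx) =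
      Projectivization.mk k (f x) ((map_ne_zero_iff f f.injective).2 hx) := by
  let F : W →ₛₗ[(σ : k →+* k)] W := { f with map_smul' := hf }
  have hF : Function.Bijective (Projectivization.map F f.injective) := by
    constructor
    · intro p q h
      induction p using Projectivization.ind with | h v hv =>
      induction q using Projectivization.ind with | h w hw =>
      rw [Projectivization.map_mk, Projectivization.map_mk, Projectivization.mk_eq_mk_iff'] at h
      obtain ⟨c, hc⟩ := h
      rw [Projectivization.mk_eq_mk_iff']
      refine ⟨σ.symm c, f.injective ?_⟩
      rw [hf, RingEquiv.apply_symm_apply]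
      exact hc
    · intro p
      induction p using Projectivization.ind with | h v hv =>
      refine ⟨Projectivization.mk k (f.symm v)
        ((map_ne_zero_iff f.symm f.symm.injective).2 hv), ?_⟩
      rw [Projectivization.map_mk]
      congr 1
      exact f.apply_symm_apply v
  exact ⟨Equiv.ofBijective _ hF, ⟨σ, f, hf, fun _ _ => rfl⟩, fun _ _ => rfl⟩

/-- The image of a linear subspace under a bijective semilinear map. -/
def semilinearImage (hf : ∀ (c : k) (x : W), f (c • x) = σ c • f x) (L : Submodule k W) :
    Submodule k W where
  carrier := {w | f.symm w ∈ L}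
  zero_mem' := by simp
  add_mem' := fun {v w} hv hw => by
    simpa using L.add_mem hv hw
  smul_mem' := fun c w hw => by
    simpa [symm_map_smul hf] using L.smul_mem (σ.symm c) hw

theorem mem_semilinearImage {hf : ∀ (c : k) (x : W), f (c • x) = σ c • f x}
    {L : Submodule k W} {w : W} : w ∈ semilinearImage hf L ↔ f.symm w ∈ L := Iff.rfl

theorem finrank_semilinearImage (hf : ∀ (c : k) (x : W), f (c • x) = σ c • f x)
    (L : Submodule k W) : Module.finrank k (semilinearImage hf L) = Module.finrank k L := by
  let j : L ≃+ semilinearImage hf L :=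
    { toFun := fun v => ⟨f v, by rw [mem_semilinearImage]; simp⟩
      invFun := fun w => ⟨f.symm w, w.2⟩
      left_inv := fun v => by simp
      right_inv := fun w => by simp
      map_add' := fun v w => by ext1; simp }
  have := rank_eq_of_equiv_equiv σ j σ.bijective fun c v => Subtype.ext (hf c v)
  rw [Module.finrank, Module.finrank, this]

end Semilinear

namespace LooseGraph

variable {V : Type u} {E : Type v} {T : LooseGraph V E} {k : Type w} [Field k]

/-- Among the three distinct points given by `v`, `w` and `v + w`, at most one is missing from X. -/
theorem IsLine.exists_pair (hE : ∀ e, T.ends e ≠ ∅) {L : Submodule k (T.Ambient k)}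
    (hL : T.IsLine k L) : ∃ v ∈ L, ∃ w ∈ L, T.IsPointVector v ∧ T.IsPointVector w ∧
      LinearIndependent k ![v, w] := by
  have : FiniteDimensional k L := Module.finite_of_finrank_eq_succ hL.1
  let B := Module.finBasisOfFinrankEq k L hL.1
  have hB : LinearIndependent k ![B 0, B 1] := by
    have h : ![B 0, B 1] = B := funext fun i => by fin_cases i <;> rfl
    rw [h]
    exact B.linearIndependent
  obtain ⟨⟨v, hv⟩, hBv⟩ : ∃ v, v = B 0 := ⟨_, rfl⟩
  obtain ⟨⟨w, hw⟩, hBw⟩ : ∃ w, w = B 1 := ⟨_, rfl⟩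
  rw [← hBv, ← hBw, LinearIndependent.pair_iff] at hB
  have hind : LinearIndependent k ![v, w] :=
    LinearIndependent.pair_iff.2 fun a b hab => hB a b (Subtype.ext hab)
  have hind' := LinearIndependent.pair_iff.1 hind
  have i1 : LinearIndependent k ![v, v + w] := by
    rw [LinearIndependent.pair_iff]
    intro a b hab
    have := hind' (a + b) b (by rw [← hab]; module)
    exact ⟨by simpa [this.2] using this.1, this.2⟩
  have i2 : LinearIndependent k ![w, v + w] := by
    rw [LinearIndependent.pair_iff]
    intro a b hab
    have := hind' b (a + b) (by rw [← hab]; module)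
    exact ⟨by simpa [this.1] using this.2, this.1⟩
  have missing : ∀ {x y : T.Ambient k}, x ∈ L → y ∈ L → LinearIndependent k ![x, y] →
      ¬T.IsPointVector x → T.IsPointVector y := by
    intro x y hx hy hxy hx'
    by_contra hy'
    have hx0 : x ≠ 0 := hxy.ne_zero 0
    obtain ⟨c, hc⟩ := hL.exists_smul_eq hE hx hy hx0 (hxy.ne_zero 1) hx' hy'
    exact (LinearIndependent.pair_iff' hx0).1 hxy c hc
  by_cases h1 : T.IsPointVector v
  · by_cases h2 : T.IsPointVector w
    · exact ⟨v, hv, w, hw, h1, h2, hind⟩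
    · exact ⟨v, hv, _, add_mem hv hw, h1, missing hw (add_mem hv hw) i2 h2, i1⟩
  · exact ⟨w, hw, _, add_mem hv hw, missing hv hw hind h1, missing hv (add_mem hv hw) i1 h1, i2⟩

theorem Line.ext_of_incident (hE : ∀ e, T.ends e ≠ ∅) {L M : T.Line k}
    (h : ∀ p, T.Incident k p L → T.Incident k p M) : L = M := by
  obtain ⟨v, hv, w, hw, hv', hw', hind⟩ := L.2.exists_pair hE
  have hsub : ∀ {x}, x ∈ L.1 → T.IsPointVector x → x ∈ M.1 := by
    intro x hx hx'
    obtain ⟨p, hp⟩ := hx'.exists_represents hE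
    rw [← hp.incident_iff] at hx ⊢
    exact h p hx
  have : FiniteDimensional k M.1 := Module.finite_of_finrank_eq_succ M.2.1
  refine Subtype.ext (Submodule.eq_of_le_of_finrank_eq (fun x hx => ?_) (L.2.1.trans M.2.1.symm))
  obtain ⟨a, b, rfl⟩ := exists_eq_of_mem_of_finrank_eq_two L.2.1 hv hw hx hind
  exact add_mem (M.1.smul_mem _ (hsub hv hv')) (M.1.smul_mem _ (hsub hw hw'))

theorem col_apply_iff {g : Equiv.Perm (T.points k) × Equiv.Perm (T.Line k)}
    (hg : g ∈ T.AutComb k) (p q r : T.points k) :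
    T.Col (g.1 p) (g.1 q) (g.1 r) ↔ T.Col p q r := by
  constructor
  · rintro ⟨L, h⟩
    obtain ⟨L, rfl⟩ := g.2.surjective L
    exact ⟨L, (hg _ _).1 h.1, (hg _ _).1 h.2.1, (hg _ _).1 h.2.2⟩
  · rintro ⟨L, h⟩
    exact ⟨g.2 L, (hg _ _).2 h.1, (hg _ _).2 h.2.1, (hg _ _).2 h.2.2⟩

theorem exists_mem_ambientStabilizer [Finite V] [Finite E] (hT : T.IsLooseTree)
    (hI : 2 ≤ T.innerVertices.ncard) {t : k} (ht0 : t ≠ 0) (ht1 : t ≠ 1)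
    {α : Equiv.Perm (T.points k)} (hα : ∀ p q r, T.Col (α p) (α q) (α r) ↔ T.Col p q r) :
    ∃ g : T.ambientStabilizer k, T.restrictHom k g = α := by
  obtain ⟨σ, f, hf, hfα⟩ := exists_addEquiv hT hI ht0 ht1 hα
  obtain ⟨g, hg, hgf⟩ := exists_mem_PGammaL hf
  have hgα : ∀ p : T.points k, g p.1 = (α p).1 := by
    intro p
    have hp := represents_rep p
    rw [hp.2, hgf]
    exact (hfα p _ hp).2.symm
  refine ⟨⟨g, hg, fun p => ⟨fun hp => ?_, fun hp => ?_⟩⟩, ?_⟩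
  · obtain ⟨q, hq⟩ := α.surjective ⟨g p, hp⟩
    have h1 : g q.1 = g p := by rw [hgα, hq]
    rw [← g.injective h1]
    exact q.2
  · rw [hgα ⟨p, hp⟩]
    exact Subtype.property _
  · exact Equiv.ext fun p => Subtype.ext (hgα p)

theorem IsLine.map {g : Equiv.Perm (ℙ k (T.Ambient k))}
    (hg : ∀ p, g p ∈ T.points k ↔ p ∈ T.points k) {L M : Submodule k (T.Ambient k)}
    (hL : T.IsLine k L) (hM : Module.finrank k M = 2)
    (h : ∀ p, g p ∈ T.pointsOf k M ↔ p ∈ T.pointsOf k L) : T.IsLine k M := by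
  refine ⟨hM, ?_⟩
  rcases hL.2 with hL | ⟨p, hp, hL⟩
  · left
    intro q hq
    obtain ⟨q, rfl⟩ := g.surjective q
    exact (hg q).2 (hL ((h q).1 hq))
  · refine Or.inr ⟨g p, (h p).2 hp, Set.ext fun q => ?_⟩
    obtain ⟨q, rfl⟩ := g.surjective q
    have := Set.ext_iff.1 hL q
    simp only [Set.mem_inter_iff, Set.mem_sdiff, Set.mem_singleton_iff, h, hg,
      g.injective.eq_iff] at this ⊢
    exact this

theorem apply_mem_pointsOf_iff {σ : k ≃+* k} {f : T.Ambient k ≃+ T.Ambient k}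
    (hf : ∀ (c : k) (x : T.Ambient k), f (c • x) = σ c • f x)
    {g : Equiv.Perm (ℙ k (T.Ambient k))}
    (hg : ∀ (x : T.Ambient k) (hx : x ≠ 0), g (Projectivization.mk k x hx) =
      Projectivization.mk k (f x) ((map_ne_zero_iff f f.injective).2 hx))
    (L : Submodule k (T.Ambient k)) (p : ℙ k (T.Ambient k)) :
    g p ∈ T.pointsOf k (semilinearImage hf L) ↔ p ∈ T.pointsOf k L := by
  induction p using Projectivization.ind with | h v hv =>
  rw [hg, mk_mem_pointsOf, mk_mem_pointsOf, mem_semilinearImage, AddEquiv.symm_apply_apply]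

theorem exists_mem_autComb (g : T.ambientStabilizer k) :
    ∃ β : Equiv.Perm (T.Line k), (T.restrictHom k g, β) ∈ T.AutComb k := by
  obtain ⟨g, ⟨σ, f, hf, hgf⟩, hg⟩ := g
  have hf' := symm_map_smul hf
  have hgf' : ∀ (x : T.Ambient k) (hx : x ≠ 0), g.symm (Projectivization.mk k x hx) =
      Projectivization.mk k (f.symm x) ((map_ne_zero_iff f.symm f.symm.injective).2 hx) := by
    intro x hx
    rw [Equiv.symm_apply_eq, hgf]
    simp
  have hg' : ∀ p, g.symm p ∈ T.points k ↔ p ∈ T.points k := by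
    intro p
    rw [← hg, Equiv.apply_symm_apply]
  refine ⟨⟨fun L => ⟨semilinearImage hf L.1, L.2.map hg
      ((finrank_semilinearImage hf L.1).trans L.2.1) (apply_mem_pointsOf_iff hf hgf L.1)⟩,
    fun L => ⟨semilinearImage hf' L.1, L.2.map hg'
      ((finrank_semilinearImage hf' L.1).trans L.2.1) (apply_mem_pointsOf_iff hf' hgf' L.1)⟩,
    fun L => ?_, fun L => ?_⟩, fun p L => apply_mem_pointsOf_iff hf hgf L.1 p.1⟩
  · refine Subtype.ext (Submodule.ext fun x => ?_)
    simp [mem_semilinearImage]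
  · refine Subtype.ext (Submodule.ext fun x => ?_)
    simp [mem_semilinearImage]

end LooseGraph

/-! ### Comparison of the two groups inside the permutations of the points. -/

theorem mainTheorem2 {V : Type u} {E : Type v} [Finite V] [Finite E]
    (T : LooseGraph V E) (hT : T.IsLooseTree) (hI : 2 ≤ T.innerVertices.ncard)
    (k : Type w) [Field k] (hk : Nat.card k ≠ 2) :
    Nonempty (T.AutComb k ≃* T.AutProj k) := by
  have hE := LooseGraph.ends_ne_empty hT hI
  -- Infinite fields are included, since their `Nat.card` is 0.
  obtain ⟨t, ht0, ht1⟩ : ∃ t : k, t ≠ 0 ∧ t ≠ 1 := by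
    by_contra! h
    refine hk (Nat.card_eq_two_iff.2 ⟨0, 1, zero_ne_one, Set.eq_univ_of_forall fun t => ?_⟩)
    by_cases ht : t = 0
    · exact Or.inl ht
    · exact Or.inr (h t ht)
  let φ : T.AutComb k →* Equiv.Perm (T.points k) :=
    (MonoidHom.fst _ _).comp (T.AutComb k).subtype
  have hφ : Function.Injective φ := by
    rintro ⟨⟨g₁, g₂⟩, hg⟩ ⟨⟨h₁, h₂⟩, hh⟩ h
    obtain rfl : g₁ = h₁ := h
    refine Subtype.ext (Prod.ext rfl (Equiv.ext fun L => ?_))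
    refine LooseGraph.Line.ext_of_incident hE fun p hp => ?_
    obtain ⟨p, rfl⟩ := g₁.surjective p
    exact (hh p L).2 ((hg p L).1 hp)
  have hrange : φ.range = (T.restrictHom k).range := by
    ext α
    constructor
    · rintro ⟨g, rfl⟩
      exact LooseGraph.exists_mem_ambientStabilizer hT hI ht0 ht1
        (LooseGraph.col_apply_iff g.2)
    · rintro ⟨g, rfl⟩
      obtain ⟨β, hβ⟩ := LooseGraph.exists_mem_autComb g
      exact ⟨⟨_, hβ⟩, rfl⟩
  exact ⟨((MonoidHom.ofInjective hφ).trans (MulEquiv.subgroupCongr hrange)).trans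
    (QuotientGroup.quotientKerEquivRange (T.restrictHom k)).symm⟩
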